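/- Let $\Omega(X,Y)={}^tXJY$, $J=\begin{pmatrix}0&I_2\\-I_2&0\end{pmatrix}$, be the standard symplectic form of $\mathbb R^4$, let $\mathcal S(4,\mathbb R)=\mathbb R^4\rtimes \mathrm{Sp}(4,\mathbb R)$ be the affine symplectic group, and identify $\mathbb R^4$ with $\mathbb C^2$ by $(x^1,x^2,x^3,x^4)\mapsto(x^1-ix^2,\;x^3+ix^4)$. Definitions. Let $M$ be a connected oriented smooth surface. A smooth immersion $f:M\to\mathbb R^4$ is Lagrangian if $\Omega$ vanishes on every $df(T_qM)$. A first order frame field along a Lagrangian immersion $f$ is a smooth map $X=(X_1,X_2,X_3,X_4):U\to\mathrm{Sp}(4,\mathbb R)$, $U\subset M$ open, such that $(X_1,X_2)|_q$ is, for every $q\in U$, a basis of the Gauss plane $\mathcal T_f(q)$, i.e. of $df(T_qM)$ with the orientation opposite to the one induced from $M$, and positive for that orientation. Write $df=\tau^jX_j$ and $X^{-1}dX=\begin{pmatrix}\alpha&\beta\\\gamma&-{}^t\alpha\end{pmatrix}$ with $2\times 2$ blocks. The immersion $f$ is elliptic if its Gauss map is spacelike for the conformal structure of the oriented Lagrangian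 Grassmannian, that is, if $g=-\gamma^1_1\gamma^2_2+(\gamma^2_1)^2$ is positive definite for first order frame fields; the conformal class of $g$ together with the orientation then gives the induced complex structure of $M$. Put $\omega=\tfrac12(\gamma^1_1-\gamma^2_2)+i\gamma^2_1$, $\tau=\tau^1-i\tau^2$ and $\eta=\tfrac12(\alpha^1_1-\alpha^2_2)-\tfrac i2(\alpha^2_1+\alpha^1_2)$. A first order frame field is of second order if $\gamma^1_1+\gamma^2_2=0$; then $\tau=t\,\omega$ and $\eta=h\,\omega+\ell\,\bar\omega$, and it is of third order if $\ell=0$. An elliptic Lagrangian immersion is totally umbilic if its normalized Hopf differential $\mathcal H=|t|^{2/3}\eta\,\omega$, computed with third order frame fields (it does not depend on their choice), vanishes identically. A complex curve without flex points is a holomorphic immersion $F$ of a connected Riemann surface into $\mathbb C^2$ such that $F_z\wedge F_{zz}\neq0$ at every point, $z$ being a local complex coordinate. Proposition. (i) If $M$ is a connected Riemann surface and $f:M\to\mathbb C^2\cong\mathbb R^4$ is a complex curve without flex points, then $f$, with $M$ oriented by its complex structure, is a totally umbilic elliptic Lagrangian immersion (in particular, third order frame fields exist around every point of $M$). (ii)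 Conversely, let $M$ be a connected oriented smooth surface and $f:M\to\mathbb R^4$ a totally umbilic elliptic Lagrangian immersion. Then there is an affine symplectic transformation $\mathcal D\in\mathcal S(4,\mathbb R)$ such that $\mathcal D\cdot f:M\to\mathbb R^4\cong\mathbb C^2$ is a complex curve without flex points for the induced complex structure of $M$. -/

import Mathlib

open scoped Manifold ContDiff Matrix

noncomputable section

namespace SymplecticSurface

/-- Real affine four-space. -/
abbrev R4 : Type := Fin 4 → ℝ

/-- The matrix of the standard symplectic form. -/
def J : Matrix (Fin 4) (Fin 4) ℝ :=
  !![0, 0, 1, 0; 0, 0, 0, 1; -1, 0, 0, 0; 0, -1, 0, 0]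

/-- The standard symplectic form `Ω(x, y) = ᵗx J y`. -/
def Om (x y : R4) : ℝ := x ⬝ᵥ (J *ᵥ y)

/-- Affine symplectic transformations `x ↦ P + A x`, with `ᵗA J A = J`. -/
structure AffineSymplectic where
  transl : R4
  lin : Matrix (Fin 4) (Fin 4) ℝ
  symplectic : linᵀ * J * lin = J

/-- The action of an affine symplectic transformation on points. -/
def AffineSymplectic.act (D : AffineSymplectic) (x : R4) : R4 := D.transl + D.lin *ᵥ x

/-- The identification of `ℝ⁴` with `ℂ²`, `(x₁, x₂, x₃, x₄) ↦ (x₁ - i x₂, x₃ + i x₄)`. -/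
def toC2 (x : R4) : ℂ × ℂ := (⟨x 0, -x 1⟩, ⟨x 2, x 3⟩)

/-- The standard area form of the oriented real plane `ℂ`. -/
def area (u v : ℂ) : ℝ := u.re * v.im - u.im * v.re

section Surface

variable {M : Type*} [TopologicalSpace M]

/-! ### Complex curves -/

/-- The charted space structure `c` over `ℂ` makes `M` a Riemann surface. -/
def IsRiemannSurface (c : ChartedSpace ℂ M) : Prop :=
  @IsManifold ℂ _ ℂ _ _ ℂ _ 𝓘(ℂ) ω M _ c

/-- `F : M → ℂ²` is a complex curve without flex points: it is a holomorphic immersion, and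
`F_z ∧ F_zz ≠ 0` at every point and for every complex coordinate `z` of the atlas. -/
structure IsFlexFreeComplexCurve (c : ChartedSpace ℂ M) (F : M → ℂ × ℂ) : Prop where
  holomorphic : MDifferentiable 𝓘(ℂ) 𝓘(ℂ, ℂ × ℂ) F
  immersion : ∀ q, Function.Injective (mfderiv 𝓘(ℂ) 𝓘(ℂ, ℂ × ℂ) F q)
  no_flex : ∀ z ∈ atlas ℂ M, ∀ q ∈ z.source,
    (deriv (F ∘ z.symm) (z q)).1 * (deriv (deriv (F ∘ z.symm)) (z q)).2
      - (deriv (F ∘ z.symm) (z q)).2 * (deriv (deriv (F ∘ z.symm)) (z q)).1 ≠ 0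

/-! ### Oriented real surfaces

The real surfaces below are modelled on the real plane `ℂ`. The tangent space at `q` is `ℂ`, seen
through the preferred chart at `q`; when the atlas is oriented, the orientation of the tangent
space is the one given by `area`. -/

variable [ChartedSpace ℂ M]

variable (M) in
/-- All coordinate changes of the atlas preserve the orientation of the real plane `ℂ`. -/
def IsOrientedAtlas : Prop :=
  ∀ e ∈ atlas ℂ M, ∀ e' ∈ atlas ℂ M, ∀ x ∈ (e.symm.trans e').source,
    0 < area (fderiv ℝ (e.symm.trans e') x 1) (fderiv ℝ (e.symm.trans e') x Complex.I)

/-- The differential of a map into `ℝ⁴`. -/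
def dR4 (f : M → R4) (q : M) (v : ℂ) : R4 := mfderiv 𝓘(ℝ, ℂ) 𝓘(ℝ, R4) f q v

/-- Smooth Lagrangian immersions into `ℝ⁴`. -/
structure IsLagrangianImmersion (f : M → R4) : Prop where
  smooth : ContMDiff 𝓘(ℝ, ℂ) 𝓘(ℝ, R4) ∞ f
  immersion : ∀ q, Function.Injective (dR4 f q)
  lagrangian : ∀ q u v, Om (dR4 f q u) (dR4 f q v) = 0

/-! ### Symplectic frame fields -/

/-- The matrix with columns `X₁, …, X₄` at `q`. -/
def frameMatrix (X : Fin 4 → M → R4) (q : M) : Matrix (Fin 4) (Fin 4) ℝ :=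
  Matrix.of fun i j => X j q i

/-- The derivative of the frame matrix at `q` in the direction `v`. -/
def frameDeriv (X : Fin 4 → M → R4) (q : M) (v : ℂ) : Matrix (Fin 4) (Fin 4) ℝ :=
  Matrix.of fun i j => dR4 (X j) q v i

/-- The pulled back Maurer--Cartan form `θ = X⁻¹ dX`, so that `dX_j = θ^i_j X_i`. Indices start
at `0`: the block `α` is `θ i j`, `γ` is `θ (i + 2) j` and `β` is `θ i (j + 2)`, for
`i, j = 0, 1`. -/
def theta (X : Fin 4 → M → R4) (q : M) (v : ℂ) : Matrix (Fin 4) (Fin 4) ℝ :=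
  (frameMatrix X q)⁻¹ * frameDeriv X q v

/-- The components of `df = τ^j X_j`. -/
def tauR (f : M → R4) (X : Fin 4 → M → R4) (q : M) (v : ℂ) : R4 :=
  (frameMatrix X q)⁻¹ *ᵥ dR4 f q v

/-- First order frame fields along `f` on the open set `U`: smooth fields of symplectic bases such
that, for each `q` in `U`, `(X₁, X₂)` is a basis of the Gauss plane, i.e. of `df(T_q M)` oriented
oppositely to the orientation induced by that of `M`. -/
structure IsFirstOrderFrame (f : M → R4) (U : Set M) (X : Fin 4 → M → R4) : Prop where
  isOpen : IsOpen U
  smooth : ∀ j, ContMDiffOn 𝓘(ℝ, ℂ) 𝓘(ℝ, R4) ∞ (X j) U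
  symplectic : ∀ q ∈ U, ∀ i j, Om (X i q) (X j q) = J i j
  gauss : ∀ q ∈ U, ∃ u₁ u₂ : ℂ, area u₁ u₂ < 0 ∧ dR4 f q u₁ = X 0 q ∧ dR4 f q u₂ = X 1 q

/-- The pull-back `-γ¹₁ γ²₂ + (γ²₁)²`, by the Gauss map lifted to the first order frame `X`, of the
quadratic form that represents the conformal structure of the oriented Lagrangian Grassmannian. -/
def gaussForm (X : Fin 4 → M → R4) (q : M) (v : ℂ) : ℝ :=
  -(theta X q v 2 0 * theta X q v 3 1) + theta X q v 3 0 ^ 2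

/-- Elliptic Lagrangian immersions: the Gauss map is a spacelike immersion, i.e. the conformal
structure of signature `(2, 1)` of the oriented Lagrangian Grassmannian, computed on a local lift
of the Gauss map to the symplectic group, pulls back to a positive definite form. -/
structure IsElliptic (f : M → R4) : Prop extends IsLagrangianImmersion f where
  spacelike : ∀ q, ∃ (U : Set M) (X : Fin 4 → M → R4),
    q ∈ U ∧ IsFirstOrderFrame f U X ∧ ∀ v : ℂ, v ≠ 0 → 0 < gaussForm X q v

/-- The complex-valued form `ω = ½(γ¹₁ - γ²₂) + i γ²₁`. -/
def omegaC (X : Fin 4 → M → R4) (q : M) (v : ℂ) : ℂ :=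
  ⟨(theta X q v 2 0 - theta X q v 3 1) / 2, theta X q v 3 0⟩

/-- The complex-valued form `τ = τ¹ - i τ²`. -/
def tauC (f : M → R4) (X : Fin 4 → M → R4) (q : M) (v : ℂ) : ℂ :=
  ⟨tauR f X q v 0, -tauR f X q v 1⟩

/-- The complex-valued form `η = ½(α¹₁ - α²₂) - (i/2)(α²₁ + α¹₂)`. -/
def etaC (X : Fin 4 → M → R4) (q : M) (v : ℂ) : ℂ :=
  ⟨(theta X q v 0 0 - theta X q v 1 1) / 2, -((theta X q v 1 0 + theta X q v 0 1) / 2)⟩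

/-- Second order frame fields: `½(γ¹₁ + γ²₂) = 0`. -/
structure IsSecondOrderFrame (f : M → R4) (U : Set M) (X : Fin 4 → M → R4) : Prop
    extends IsFirstOrderFrame f U X where
  trace_gamma : ∀ q ∈ U, ∀ v, (theta X q v 2 0 + theta X q v 3 1) / 2 = 0

/-- Third order frame fields: in `η = h ω + ℓ ω̄` the coefficient `ℓ` is zero. -/
structure IsThirdOrderFrame (f : M → R4) (U : Set M) (X : Fin 4 → M → R4) : Prop
    extends IsSecondOrderFrame f U X where
  eta_type : ∃ h : M → ℂ, ∀ q ∈ U, ∀ v, etaC X q v = h q * omegaC X q v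

/-- The coefficient `t` in `τ = t ω`, computed on the tangent vector `1`, where `ω` is nonzero
for second order frames along an elliptic immersion. -/
def tCoeff (f : M → R4) (X : Fin 4 → M → R4) (q : M) : ℂ := tauC f X q 1 / omegaC X q 1

/-- The normalized Hopf differential `|t|^(2/3) η ω` (a quadratic form on the tangent space),
computed with the third order frame `X`; it does not depend on that frame. -/
def hopf (f : M → R4) (X : Fin 4 → M → R4) (q : M) (v : ℂ) : ℂ :=
  ((‖tCoeff f X q‖ ^ (2 / 3 : ℝ) : ℝ) : ℂ) * (etaC X q v * omegaC X q v)

/-- There are third order frame fields around every point. -/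
def HasThirdOrderFrames (f : M → R4) : Prop :=
  ∀ q : M, ∃ (U : Set M) (X : Fin 4 → M → R4), q ∈ U ∧ IsThirdOrderFrame f U X

/-- Totally umbilic elliptic Lagrangian immersions: the normalized Hopf differential, computed
with any third order frame, vanishes identically. -/
structure IsTotallyUmbilic (f : M → R4) : Prop extends IsElliptic f where
  hopf_eq_zero : ∀ (U : Set M) (X : Fin 4 → M → R4), IsThirdOrderFrame f U X →
    ∀ q ∈ U, ∀ v, hopf f X q v = 0

/-- `z` is a complex coordinate of the oriented smooth surface `M` for the complex structure
determined by its orientation and by the conformal structure induced by the Gauss map of `f`: a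
smooth, orientation preserving and conformal chart of `M`. -/
structure IsInducedCoordinate (f : M → R4) (z : OpenPartialHomeomorph M ℂ) : Prop where
  smooth : z ∈ IsManifold.maximalAtlas 𝓘(ℝ, ℂ) ∞ M
  oriented : ∀ q ∈ z.source, 0 <
    area (mfderiv 𝓘(ℝ, ℂ) 𝓘(ℝ, ℂ) z q (1 : ℂ)) (mfderiv 𝓘(ℝ, ℂ) 𝓘(ℝ, ℂ) z q Complex.I)
  conformal : ∀ q ∈ z.source, ∀ (U : Set M) (X : Fin 4 → M → R4), q ∈ U →
    IsFirstOrderFrame f U X → ∃ r : ℝ, 0 < r ∧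
      ∀ v : ℂ, gaussForm X q v = r * Complex.normSq (mfderiv 𝓘(ℝ, ℂ) 𝓘(ℝ, ℂ) z q v)

/-- `c` is (an atlas of) the complex structure determined by the orientation of the smooth surface
`(M, s)` and by the conformal structure induced by the Gauss map of `f`. -/
structure IsInducedComplexStructure (s : ChartedSpace ℂ M) (f : M → R4)
    (c : ChartedSpace ℂ M) : Prop where
  riemann : IsRiemannSurface c
  coordinates : ∀ z ∈ c.atlas, @IsInducedCoordinate M _ s f z

end Surface

end SymplecticSurface

end

/-!
In a coordinate domain an immersion `φ` of the plane carries the cubic form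
`Om (Dφ a) (D²φ (v, b))` (`cubic`), which is symmetric because `φ` is Lagrangian. For a first
order frame the forms `γ` are the values of the cubic form on the tangent vectors of the frame
(`IsPlaneFrame.gamma_eq_cubic`), so the quadratic form pulled back by the Gauss map is, up to a
positive factor, the Hessian covariant `hess` of the cubic form (`exists_gaussForm_eq`). This
makes ellipticity and the conformal class independent of frames. A first order frame is of second
order when its tangent vectors are conformal for `hess`, because a cubic form is apolar to its
Hessian; the structure equation for the trace of `γ` makes the coefficient `ℓ` of `η = h ω + ℓ ω̄`
real, and a shear of the last two frame vectors removes it. Hence third order frames exist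
(`exists_isThirdOrderFrame`).

The link with complex curves is the complex structure `cplx X` of `ℝ⁴` with `N X₁ = -X₂` and
`N X₃ = X₄`. For the standard basis it is multiplication by `i` in the identification with `ℂ²`, and
`Om` is the real part of the complex area form.

* Let `f` be a complex curve. Its cubic form is the real part of `(F_z ∧ F_zz) dz³`, so it is
  elliptic with `z` as conformal coordinate, and the Gauss plane spanned by a second order frame
  is an oriented complex line: `i X₁ = -X₂` for the constant complex structure `i`.
  Differentiation of this relation gives `η = -(s/2) ω̄`, where `s` measures the failure of the
  frame to be unitary (`eta_of_adapted`). Third order frames therefore have `s = 0` and `η = 0`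
  (`isTotallyUmbilic_of_complexCurve`).

* Let `f` be totally umbilic. As `t` and `ω` do not vanish, third order frames have `η = 0`. Then
  the structure equation for `η` forces `β` to be trace free (`trace_beta_eq_zero`), the whole
  Maurer--Cartan form commutes with the complex structure, and `cplx X` is locally constant
  (`fderiv_cplx_eq_zero`). It does not depend on the frame (`IsTotallyUmbilic.cplx_eq`), so it is
  constant on the connected surface. A linear symplectic map that takes it to `i` takes the
  tangent planes to complex lines. The components of the transformed immersion are then local
  complex coordinates (`exists_holomorphic_coordinate`), in which the immersion is holomorphic;
  they are positive and conformal for the structure induced by the Gauss map, by the formula for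
  `hess` on complex curves.
-/

noncomputable section

namespace SymplecticSurface

open Filter
open scoped Topology

/-! ### Symplectic linear algebra -/

lemma Om_eq (x y : R4) : Om x y = x 0 * y 2 + x 1 * y 3 - x 2 * y 0 - x 3 * y 1 := by
  simp [Om, J, dotProduct, Matrix.mulVec, Fin.sum_univ_four]
  ring

lemma Om_self (x : R4) : Om x x = 0 := by rw [Om_eq]; ring

lemma Om_swap (x y : R4) : Om x y = -Om y x := by simp only [Om_eq]; ring

lemma Om_add_left (x y z : R4) : Om (x + y) z = Om x z + Om y z := by
  simp only [Om_eq, Pi.add_apply]; ring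

lemma Om_add_right (x y z : R4) : Om x (y + z) = Om x y + Om x z := by
  simp only [Om_eq, Pi.add_apply]; ring

lemma Om_sub_left (x y z : R4) : Om (x - y) z = Om x z - Om y z := by
  simp only [Om_eq, Pi.sub_apply]; ring

lemma Om_sub_right (x y z : R4) : Om x (y - z) = Om x y - Om x z := by
  simp only [Om_eq, Pi.sub_apply]; ring

lemma Om_smul_left (c : ℝ) (x z : R4) : Om (c • x) z = c * Om x z := by
  simp only [Om_eq, Pi.smul_apply, smul_eq_mul]; ring

lemma Om_smul_right (c : ℝ) (x z : R4) : Om x (c • z) = c * Om x z := by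
  simp only [Om_eq, Pi.smul_apply, smul_eq_mul]; ring

lemma Om_neg_left (x z : R4) : Om (-x) z = -Om x z := by
  simp only [Om_eq, Pi.neg_apply]; ring

lemma Om_neg_right (x z : R4) : Om x (-z) = -Om x z := by
  simp only [Om_eq, Pi.neg_apply]; ring

lemma Om_zero_left (z : R4) : Om 0 z = 0 := by simp [Om_eq]

/-- The symplectic form as a continuous bilinear map. -/
def OmCLM : R4 →L[ℝ] R4 →L[ℝ] ℝ :=
  (LinearMap.mk₂ ℝ Om Om_add_left Om_smul_left Om_add_right Om_smul_right).toContinuousBilinearMap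

lemma OmCLM_apply (x y : R4) : OmCLM x y = Om x y := rfl

/-- A symplectic basis of `ℝ⁴`: the Gram matrix of `Om` is `J`. -/
def IsSymplecticBasis (e : Fin 4 → R4) : Prop := ∀ i j, Om (e i) (e j) = J i j

lemma symplectic_mul_eq (A : Matrix (Fin 4) (Fin 4) ℝ) (hA : Aᵀ * J * A = J) :
    (-(J * Aᵀ * J)) * A = 1 := by
  have hJ : J * J = -1 := by
    ext i j; fin_cases i <;> fin_cases j <;> simp [J, Matrix.mul_apply, Fin.sum_univ_four]
  calc (-(J * Aᵀ * J)) * A = -(J * (Aᵀ * J * A)) := by simp only [Matrix.mul_assoc, neg_mul]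
    _ = 1 := by rw [hA, hJ, neg_neg]

lemma Om_mulVec (A : Matrix (Fin 4) (Fin 4) ℝ) (hA : Aᵀ * J * A = J) (x y : R4) :
    Om (A *ᵥ x) (A *ᵥ y) = Om x y := by
  unfold Om
  conv_rhs => rw [← hA]
  rw [← Matrix.mulVec_mulVec, ← Matrix.mulVec_mulVec, Matrix.dotProduct_mulVec x,
    Matrix.vecMul_transpose]

namespace IsSymplecticBasis

variable {e : Fin 4 → R4} (he : IsSymplecticBasis e)
include he

lemma matrix_symplectic :
    (Matrix.of fun i j => e j i)ᵀ * J * (Matrix.of fun i j => e j i) = J := by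
  ext i j
  rw [← he i j, Om_eq]
  simp [Matrix.mul_apply, Fin.sum_univ_four, J]
  ring

lemma inv_eq : (Matrix.of fun i j => e j i : Matrix (Fin 4) (Fin 4) ℝ)⁻¹
    = -(J * (Matrix.of fun i j => e j i)ᵀ * J) :=
  Matrix.inv_eq_left_inv (symplectic_mul_eq _ he.matrix_symplectic)

lemma inv_mulVec (x : R4) : (Matrix.of fun i j => e j i : Matrix (Fin 4) (Fin 4) ℝ)⁻¹ *ᵥ x
    = ![-Om (e 2) x, -Om (e 3) x, Om (e 0) x, Om (e 1) x] := by
  have hJ : ∀ y : R4, J *ᵥ y = ![y 2, y 3, -y 0, -y 1] := fun y => by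
    ext i
    fin_cases i <;> simp [J, Matrix.mulVec, dotProduct, Fin.sum_univ_four]
  rw [he.inv_eq, Matrix.neg_mulVec, ← Matrix.mulVec_mulVec, ← Matrix.mulVec_mulVec, hJ, hJ]
  ext i
  fin_cases i <;> simp [Om_eq, Matrix.mulVec, dotProduct, Fin.sum_univ_four] <;> ring

lemma expand (x : R4) :
    x = Om x (e 2) • e 0 + Om x (e 3) • e 1 - Om x (e 0) • e 2 - Om x (e 1) • e 3 := by
  have h1 := he.inv_mulVec x
  have h2 : (Matrix.of fun i j => e j i : Matrix (Fin 4) (Fin 4) ℝ) *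
      (Matrix.of fun i j => e j i : Matrix (Fin 4) (Fin 4) ℝ)⁻¹ = 1 := by
    rw [he.inv_eq]
    exact mul_eq_one_comm.1 (symplectic_mul_eq _ he.matrix_symplectic)
  have h3 : (Matrix.of fun i j => e j i : Matrix (Fin 4) (Fin 4) ℝ) *ᵥ
      ((Matrix.of fun i j => e j i : Matrix (Fin 4) (Fin 4) ℝ)⁻¹ *ᵥ x) = x := by
    rw [Matrix.mulVec_mulVec, h2, Matrix.one_mulVec]
  rw [h1] at h3
  conv_lhs => rw [← h3]
  ext i
  simp [Matrix.mulVec, dotProduct, Fin.sum_univ_four, Om_swap x]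
  ring

lemma Om_expand (x y : R4) :
    Om x y = Om x (e 2) * Om (e 0) y + Om x (e 3) * Om (e 1) y
      - Om x (e 0) * Om (e 2) y - Om x (e 1) * Om (e 3) y := by
  conv_lhs => rw [he.expand x]
  simp only [Om_add_left, Om_sub_left, Om_smul_left]

lemma om01 : Om (e 0) (e 1) = 0 := by rw [he]; simp [J]
lemma om02 : Om (e 0) (e 2) = 1 := by rw [he]; simp [J]
lemma om03 : Om (e 0) (e 3) = 0 := by rw [he]; simp [J]
lemma om12 : Om (e 1) (e 2) = 0 := by rw [he]; simp [J]
lemma om13 : Om (e 1) (e 3) = 1 := by rw [he]; simp [J]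
lemma om23 : Om (e 2) (e 3) = 0 := by rw [he]; simp [J]

end IsSymplecticBasis

lemma isSymplecticBasis_of {e : Fin 4 → R4} (h01 : Om (e 0) (e 1) = 0) (h02 : Om (e 0) (e 2) = 1)
    (h03 : Om (e 0) (e 3) = 0) (h12 : Om (e 1) (e 2) = 0) (h13 : Om (e 1) (e 3) = 1)
    (h23 : Om (e 2) (e 3) = 0) : IsSymplecticBasis e := by
  intro i j
  fin_cases i <;> fin_cases j <;>
    simp [J, h01, h02, h03, h12, h13, h23, Om_self, Om_swap (e 1) (e 0), Om_swap (e 2) (e 0),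
      Om_swap (e 3) (e 0), Om_swap (e 2) (e 1), Om_swap (e 3) (e 1), Om_swap (e 3) (e 2)]

/-- The complex structure `N` of `ℝ⁴` with `N e₀ = -e₁` and `N e₂ = e₃`, for a symplectic
basis `e`. -/
def cplx (e : Fin 4 → R4) : R4 →ₗ[ℝ] R4 where
  toFun x := Om x (e 3) • e 0 - Om x (e 2) • e 1 + Om x (e 1) • e 2 - Om x (e 0) • e 3
  map_add' x y := by simp only [Om_add_left, add_smul]; abel
  map_smul' c x := by
    simp only [Om_smul_left, mul_smul, RingHom.id_apply, smul_sub, smul_add]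

lemma cplx_apply (e : Fin 4 → R4) (x : R4) :
    cplx e x = Om x (e 3) • e 0 - Om x (e 2) • e 1 + Om x (e 1) • e 2 - Om x (e 0) • e 3 := rfl

/-- Complex structures `N` of `ℝ⁴` that are self-adjoint for `Om`, i.e. for which `Om` is the real
part of a complex area form. -/
structure IsOmComplex (N : R4 →ₗ[ℝ] R4) : Prop where
  sq : ∀ x, N (N x) = -x
  adj : ∀ x y, Om (N x) y = Om x (N y)

namespace IsSymplecticBasis

variable {e : Fin 4 → R4} (he : IsSymplecticBasis e)
include he

lemma cplx_zero : cplx e (e 0) = -e 1 := by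
  simp [cplx_apply, he.om01, he.om02, he.om03, Om_self]

lemma cplx_one : cplx e (e 1) = e 0 := by
  simp [cplx_apply, Om_swap (e 1) (e 0), he.om01, he.om12, he.om13, Om_self]

lemma cplx_two : cplx e (e 2) = e 3 := by
  simp [cplx_apply, Om_swap (e 2) (e 0), Om_swap (e 2) (e 1), he.om02, he.om12, he.om23, Om_self]

lemma cplx_three : cplx e (e 3) = -e 2 := by
  simp [cplx_apply, Om_swap (e 3) (e 0), Om_swap (e 3) (e 1), Om_swap (e 3) (e 2), he.om03,
    he.om13, he.om23, Om_self]

lemma isOmComplex_cplx : IsOmComplex (cplx e) where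
  sq x := by
    rw [cplx_apply e x]
    simp only [map_add, map_sub, map_smul, he.cplx_zero, he.cplx_one, he.cplx_two, he.cplx_three]
    conv_rhs => rw [he.expand x]
    module
  adj x y := by
    simp only [cplx_apply, Om_add_left, Om_sub_left, Om_smul_left, Om_add_right, Om_sub_right,
      Om_smul_right, Om_swap y (e _)]
    ring

lemma eq_cplx {N : R4 →ₗ[ℝ] R4} (h0 : N (e 0) = -e 1) (h1 : N (e 1) = e 0) (h2 : N (e 2) = e 3)
    (h3 : N (e 3) = -e 2) : N = cplx e := by
  refine LinearMap.ext fun x => ?_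
  conv_lhs => rw [he.expand x]
  conv_rhs => rw [he.expand x]
  simp only [map_add, map_sub, map_smul, he.cplx_zero, he.cplx_one, he.cplx_two, he.cplx_three,
    h0, h1, h2, h3]

end IsSymplecticBasis

/-! ### Derivatives of the coefficients of a moving frame -/

lemma fderiv_Om {Y Z : ℂ → R4} {p : ℂ} (hY : DifferentiableAt ℝ Y p) (hZ : DifferentiableAt ℝ Z p)
    (v : ℂ) : fderiv ℝ (fun p => Om (Y p) (Z p)) p v
      = Om (fderiv ℝ Y p v) (Z p) + Om (Y p) (fderiv ℝ Z p v) := by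
  have h := (OmCLM.hasFDerivAt_of_bilinear hY.hasFDerivAt hZ.hasFDerivAt).fderiv
  have h2 : (fun p => OmCLM (Y p) (Z p)) = fun p => Om (Y p) (Z p) := rfl
  rw [h2] at h
  rw [h]
  simp [OmCLM_apply, add_comm]

lemma contDiffOn_Om {Y Z : ℂ → R4} {V : Set ℂ} {n : ℕ∞} (hY : ContDiffOn ℝ n Y V)
    (hZ : ContDiffOn ℝ n Z V) : ContDiffOn ℝ n (fun p => Om (Y p) (Z p)) V := by
  simp only [Om_eq]
  have h1 := fun i => (contDiffOn_pi.1 hY) i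
  have h2 := fun i => (contDiffOn_pi.1 hZ) i
  exact ((((h1 0).mul (h2 2)).add ((h1 1).mul (h2 3))).sub ((h1 2).mul (h2 0))).sub
    ((h1 3).mul (h2 1))

/-- The coefficients `Om (Y_i, D_v Y_j)` of the derivative of a moving frame. For a symplectic
frame they are the entries of the Maurer--Cartan form `θ`: with rows and columns numbered from `0`,
`θ 0 j = -conn 2 j`, `θ 1 j = -conn 3 j`, `θ 2 j = conn 0 j` and `θ 3 j = conn 1 j`. -/
def conn (Y : Fin 4 → ℂ → R4) (p v : ℂ) (i j : Fin 4) : ℝ := Om (Y i p) (fderiv ℝ (Y j) p v)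

lemma conn_symm {Y : Fin 4 → ℂ → R4} {p : ℂ} (hs : ∀ᶠ p' in 𝓝 p, IsSymplecticBasis fun i => Y i p')
    (hd : ∀ i, DifferentiableAt ℝ (Y i) p) (v : ℂ) (i j : Fin 4) :
    conn Y p v i j = conn Y p v j i := by
  have h : (fun p' => Om (Y i p') (Y j p')) =ᶠ[𝓝 p] fun _ => J i j := by
    filter_upwards [hs] with p' hp using hp i j
  have h2 := h.fderiv_eq (𝕜 := ℝ)
  have h3 := fderiv_Om (hd i) (hd j) v
  rw [h2] at h3
  simp only [fderiv_fun_const, Pi.zero_apply, zero_apply] at h3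
  unfold conn
  rw [Om_swap (fderiv ℝ (Y i) p v)] at h3
  linarith

lemma differentiableAt_fderiv_apply {Z : ℂ → R4} {p : ℂ} (hZ : ContDiffAt ℝ 2 Z p) (v : ℂ) :
    DifferentiableAt ℝ (fun p => fderiv ℝ Z p v) p :=
  (((hZ.fderiv_right (m := 1) (by norm_num)).differentiableAt (by norm_num))).clm_apply
    (differentiableAt_const v)

lemma fderiv_fderiv_apply {Z : ℂ → R4} {p : ℂ} (hZ : ContDiffAt ℝ 2 Z p) (v w : ℂ) :
    fderiv ℝ (fun p => fderiv ℝ Z p v) p w = fderiv ℝ (fderiv ℝ Z) p w v := by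
  have h := (((hZ.fderiv_right (m := 1) (by norm_num)).differentiableAt (by norm_num)))
  rw [fderiv_clm_apply h (differentiableAt_const v)]
  simp

lemma sndDeriv_symm {Z : ℂ → R4} {p : ℂ} (hZ : ContDiffAt ℝ 2 Z p) (v w : ℂ) :
    fderiv ℝ (fderiv ℝ Z) p w v = fderiv ℝ (fderiv ℝ Z) p v w :=
  (hZ.isSymmSndFDerivAt (by simp)).eq w v

/-- The Maurer--Cartan equation in terms of the coefficients `conn`. -/
lemma structure_equation {Y : Fin 4 → ℂ → R4} {p : ℂ} (hd : ∀ i, ContDiffAt ℝ 2 (Y i) p) (v w : ℂ)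
    (i j : Fin 4) :
    fderiv ℝ (fun p => conn Y p v i j) p w - fderiv ℝ (fun p => conn Y p w i j) p v
      = Om (fderiv ℝ (Y i) p w) (fderiv ℝ (Y j) p v)
        - Om (fderiv ℝ (Y i) p v) (fderiv ℝ (Y j) p w) := by
  have h0 : ∀ i, DifferentiableAt ℝ (Y i) p := fun i => (hd i).differentiableAt (by norm_num)
  unfold conn
  rw [fderiv_Om (h0 i) (differentiableAt_fderiv_apply (hd j) v),
    fderiv_Om (h0 i) (differentiableAt_fderiv_apply (hd j) w), fderiv_fderiv_apply (hd j),
    fderiv_fderiv_apply (hd j), sndDeriv_symm (hd j) v w]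
  ring

lemma differentiableAt_conn {Y : Fin 4 → ℂ → R4} {p : ℂ} (hd : ∀ i, ContDiffAt ℝ 2 (Y i) p) (v : ℂ)
    (i j : Fin 4) : DifferentiableAt ℝ (fun p => conn Y p v i j) p :=
  (OmCLM.hasFDerivAt_of_bilinear ((hd i).differentiableAt (by norm_num)).hasFDerivAt
    (differentiableAt_fderiv_apply (hd j) v).hasFDerivAt).differentiableAt

lemma Om_fderiv_fderiv {Y : Fin 4 → ℂ → R4} {p : ℂ} (hs : IsSymplecticBasis fun i => Y i p)
    (v w : ℂ) (i j : Fin 4) :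
    Om (fderiv ℝ (Y i) p w) (fderiv ℝ (Y j) p v)
      = -conn Y p w 2 i * conn Y p v 0 j - conn Y p w 3 i * conn Y p v 1 j
        + conn Y p w 0 i * conn Y p v 2 j + conn Y p w 1 i * conn Y p v 3 j := by
  rw [hs.Om_expand (fderiv ℝ (Y i) p w)]
  simp only [conn, Om_swap (fderiv ℝ (Y i) p w)]
  ring

/-! ### Consequences of the structure equations -/

lemma re_im_smul (v : ℂ) : v = v.re • (1 : ℂ) + v.im • Complex.I := by
  apply Complex.ext <;> simp

lemma conn_re_im (Y : Fin 4 → ℂ → R4) (p v : ℂ) (i j : Fin 4) :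
    conn Y p v i j = v.re * conn Y p 1 i j + v.im * conn Y p Complex.I i j := by
  conv_lhs => rw [re_im_smul v]
  simp only [conn, map_add, map_smul, Om_add_right, Om_smul_right]

/-- Two real linear forms on the plane whose squares add up to a positive definite form are
linearly independent. -/
lemma det_ne_zero_of_sq_add_sq_pos {a₁ a₂ b₁ b₂ : ℝ}
    (h : ∀ x y : ℝ, x ≠ 0 ∨ y ≠ 0 → 0 < (x * a₁ + y * a₂) ^ 2 + (x * b₁ + y * b₂) ^ 2) :
    a₁ * b₂ - a₂ * b₁ ≠ 0 := by
  intro hdet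
  have hb : ¬ (b₂ ≠ 0 ∨ -b₁ ≠ 0) := fun hb => by
    have := h _ _ hb
    have e : (b₂ * a₁ + -b₁ * a₂) ^ 2 + (b₂ * b₁ + -b₁ * b₂) ^ 2
        = (a₁ * b₂ - a₂ * b₁) ^ 2 := by ring
    rw [e, hdet] at this
    norm_num at this
  have ha : ¬ (a₂ ≠ 0 ∨ -a₁ ≠ 0) := fun ha => by
    have := h _ _ ha
    have e : (a₂ * a₁ + -a₁ * a₂) ^ 2 + (a₂ * b₁ + -a₁ * b₂) ^ 2
        = (a₁ * b₂ - a₂ * b₁) ^ 2 := by ring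
    rw [e, hdet] at this
    norm_num at this
  push Not at ha hb
  have := h 1 0 (Or.inl one_ne_zero)
  rw [hb.1, neg_eq_zero.1 hb.2, ha.1, neg_eq_zero.1 ha.2] at this
  norm_num at this

section Frame

variable {Y : Fin 4 → ℂ → R4} {p : ℂ}

/-- The real part of `η ∧ ω` vanishes for second order frames, so that the coefficient `ℓ` of
`η = h ω + ℓ ω̄` is real: this is the structure equation for the trace of `γ`. -/
lemma trace_gamma_relation (hs : ∀ᶠ p' in 𝓝 p, IsSymplecticBasis fun i => Y i p')
    (hd : ∀ i, ContDiffAt ℝ 2 (Y i) p)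
    (h2 : ∀ᶠ p' in 𝓝 p, ∀ v, conn Y p' v 0 0 + conn Y p' v 1 1 = 0) (v w : ℂ) :
    (conn Y p w 2 0 - conn Y p w 3 1) * conn Y p v 0 0
        + (conn Y p w 3 0 + conn Y p w 2 1) * conn Y p v 1 0
      = (conn Y p v 2 0 - conn Y p v 3 1) * conn Y p w 0 0
        + (conn Y p v 3 0 + conn Y p v 2 1) * conn Y p w 1 0 := by
  have h0 : ∀ i, DifferentiableAt ℝ (Y i) p := fun i => (hd i).differentiableAt (by norm_num)
  have hz : ∀ v w, fderiv ℝ (fun p => conn Y p v 0 0) p w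
      + fderiv ℝ (fun p => conn Y p v 1 1) p w = 0 := by
    intro v w
    have e : (fun p' => conn Y p' v 0 0 + conn Y p' v 1 1) =ᶠ[𝓝 p] fun _ => 0 := by
      filter_upwards [h2] with p' hp using hp v
    have := e.fderiv_eq (𝕜 := ℝ)
    rw [fderiv_fun_add (differentiableAt_conn hd v 0 0) (differentiableAt_conn hd v 1 1)] at this
    simpa using congrArg (fun L => L w) this
  have e0 := structure_equation hd v w 0 0
  have e1 := structure_equation hd v w 1 1
  simp only [Om_fderiv_fderiv hs.self_of_nhds] at e0 e1
  have sv := conn_symm hs h0 v 0 1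
  have sw := conn_symm hs h0 w 0 1
  have tv := h2.self_of_nhds v
  have tw := h2.self_of_nhds w
  have tv' : conn Y p v 1 1 = -conn Y p v 0 0 := by linarith
  have tw' : conn Y p w 1 1 = -conn Y p w 0 0 := by linarith
  rw [sv, sw] at e1
  rw [tv', tw'] at e1
  have z1 := hz v w
  have z2 := hz w v
  linear_combination (e0 + e1 - z1 + z2) / 2

/-- For second order frames with `η = 0`, the structure equation for `η` makes `β` trace free. -/
lemma trace_beta_eq_zero (hs : ∀ᶠ p' in 𝓝 p, IsSymplecticBasis fun i => Y i p')
    (hd : ∀ i, ContDiffAt ℝ 2 (Y i) p)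
    (h2 : ∀ v, conn Y p v 0 0 + conn Y p v 1 1 = 0)
    (h3 : ∀ᶠ p' in 𝓝 p, ∀ v, conn Y p' v 2 0 - conn Y p' v 3 1 = 0)
    (h4 : ∀ᶠ p' in 𝓝 p, ∀ v, conn Y p' v 3 0 + conn Y p' v 2 1 = 0)
    (hdet : conn Y p 1 0 0 * conn Y p Complex.I 1 0
      - conn Y p Complex.I 0 0 * conn Y p 1 1 0 ≠ 0) (v : ℂ) :
    conn Y p v 2 2 + conn Y p v 3 3 = 0 := by
  have h0 : ∀ i, DifferentiableAt ℝ (Y i) p := fun i => (hd i).differentiableAt (by norm_num)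
  have hz3 : ∀ v w, fderiv ℝ (fun p => conn Y p v 2 0) p w
      - fderiv ℝ (fun p => conn Y p v 3 1) p w = 0 := by
    intro v w
    have e : (fun p' => conn Y p' v 2 0 - conn Y p' v 3 1) =ᶠ[𝓝 p] fun _ => 0 := by
      filter_upwards [h3] with p' hp using hp v
    have := e.fderiv_eq (𝕜 := ℝ)
    rw [fderiv_fun_sub (differentiableAt_conn hd v 2 0) (differentiableAt_conn hd v 3 1)] at this
    simpa using congrArg (fun L => L w) this
  have hz4 : ∀ v w, fderiv ℝ (fun p => conn Y p v 3 0) p w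
      + fderiv ℝ (fun p => conn Y p v 2 1) p w = 0 := by
    intro v w
    have e : (fun p' => conn Y p' v 3 0 + conn Y p' v 2 1) =ᶠ[𝓝 p] fun _ => 0 := by
      filter_upwards [h4] with p' hp using hp v
    have := e.fderiv_eq (𝕜 := ℝ)
    rw [fderiv_fun_add (differentiableAt_conn hd v 3 0) (differentiableAt_conn hd v 2 1)] at this
    simpa using congrArg (fun L => L w) this
  have sub : ∀ v, conn Y p v 1 1 = -conn Y p v 0 0 ∧ conn Y p v 3 1 = conn Y p v 2 0 ∧
      conn Y p v 2 1 = -conn Y p v 3 0 := fun v =>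
    ⟨by linarith [h2 v], by linarith [h3.self_of_nhds v], by linarith [h4.self_of_nhds v]⟩
  have key : ∀ v w, ((conn Y p w 2 2 + conn Y p w 3 3) * conn Y p v 0 0
      = (conn Y p v 2 2 + conn Y p v 3 3) * conn Y p w 0 0) ∧
      ((conn Y p w 2 2 + conn Y p w 3 3) * conn Y p v 1 0
      = (conn Y p v 2 2 + conn Y p v 3 3) * conn Y p w 1 0) := by
    intro v w
    have e20 := structure_equation hd v w 2 0
    have e31 := structure_equation hd v w 3 1
    have e30 := structure_equation hd v w 3 0
    have e21 := structure_equation hd v w 2 1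
    simp only [Om_fderiv_fderiv hs.self_of_nhds] at e20 e31 e30 e21
    simp only [conn_symm hs h0 _ 0 1, conn_symm hs h0 _ 0 2, conn_symm hs h0 _ 0 3,
      conn_symm hs h0 _ 1 2, conn_symm hs h0 _ 1 3, conn_symm hs h0 _ 2 3] at e20 e31 e30 e21
    simp only [(sub v).1, (sub w).1, (sub v).2.1, (sub w).2.1, (sub v).2.2, (sub w).2.2]
      at e20 e31 e30 e21
    have a1 := hz3 v w
    have a2 := hz3 w v
    have b1 := hz4 v w
    have b2 := hz4 w v
    constructor
    · linear_combination e20 - e31 - a1 + a2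
    · linear_combination e30 + e21 - b1 + b2
  obtain ⟨k1, k2⟩ := key 1 Complex.I
  have z1 : conn Y p 1 2 2 + conn Y p 1 3 3 = 0 := by
    refine (mul_eq_zero.1 ?_).resolve_right hdet
    linear_combination conn Y p 1 1 0 * k1 - conn Y p 1 0 0 * k2
  have zI : conn Y p Complex.I 2 2 + conn Y p Complex.I 3 3 = 0 := by
    refine (mul_eq_zero.1 ?_).resolve_right hdet
    linear_combination conn Y p Complex.I 1 0 * k1 - conn Y p Complex.I 0 0 * k2
  rw [conn_re_im Y p v 2 2, conn_re_im Y p v 3 3]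
  linear_combination v.re * z1 + v.im * zI

/-- If the Maurer--Cartan form of a frame takes its values in the complex matrices, then the
complex structure of `ℝ⁴` for which the frame is unitary is stationary. -/
lemma fderiv_cplx_eq_zero (hs : ∀ᶠ p' in 𝓝 p, IsSymplecticBasis fun i => Y i p')
    (h0 : ∀ i, DifferentiableAt ℝ (Y i) p)
    (h2 : ∀ v, conn Y p v 0 0 + conn Y p v 1 1 = 0)
    (h3 : ∀ v, conn Y p v 2 0 - conn Y p v 3 1 = 0)
    (h4 : ∀ v, conn Y p v 3 0 + conn Y p v 2 1 = 0)
    (h5 : ∀ v, conn Y p v 2 2 + conn Y p v 3 3 = 0) (x : R4) :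
    HasFDerivAt (fun p => cplx (fun i => Y i p) x) (0 : ℂ →L[ℝ] R4) p := by
  have hY := fun i => (h0 i).hasFDerivAt
  have hx : ∀ i, HasFDerivAt (fun p => Om x (Y i p)) ((OmCLM x).comp (fderiv ℝ (Y i) p)) p :=
    fun i => (OmCLM x).hasFDerivAt.comp p (hY i)
  have h := ((((hx 3).smul (hY 0)).sub ((hx 2).smul (hY 1))).add ((hx 1).smul (hY 2))).sub
    ((hx 0).smul (hY 3))
  refine (h.congr_fderiv ?_ :)
  refine ContinuousLinearMap.ext fun v => ?_
  have hD : ∀ j, fderiv ℝ (Y j) p v = -conn Y p v 2 j • Y 0 p + -conn Y p v 3 j • Y 1 p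
      + conn Y p v 0 j • Y 2 p + conn Y p v 1 j • Y 3 p := by
    intro j
    rw [hs.self_of_nhds.expand (fderiv ℝ (Y j) p v)]
    simp only [conn, Om_swap (fderiv ℝ (Y j) p v)]
    module
  have sub : ∀ v, conn Y p v 1 1 = -conn Y p v 0 0 ∧ conn Y p v 3 1 = conn Y p v 2 0 ∧
      conn Y p v 2 1 = -conn Y p v 3 0 ∧ conn Y p v 3 3 = -conn Y p v 2 2 := fun v =>
    ⟨by linarith [h2 v], by linarith [h3 v], by linarith [h4 v], by linarith [h5 v]⟩
  simp only [add_apply, sub_apply, smul_apply, ContinuousLinearMap.smulRight_apply,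
    ContinuousLinearMap.comp_apply, OmCLM_apply, zero_apply]
  simp only [hD, Om_add_right, Om_smul_right, conn_symm hs h0 _ 0 1, conn_symm hs h0 _ 0 2,
    conn_symm hs h0 _ 0 3, conn_symm hs h0 _ 1 2, conn_symm hs h0 _ 1 3, conn_symm hs h0 _ 2 3]
  simp only [(sub v).1, (sub v).2.1, (sub v).2.2.1, (sub v).2.2.2]
  module

/-- Frames adapted to a constant complex structure `N`: here `η = -(s/2) ω̄`, where `s` measures
the failure of the frame to be unitary for `N`. -/
lemma eta_of_adapted {N : R4 →ₗ[ℝ] R4} (hN : IsOmComplex N) (hs : IsSymplecticBasis fun i => Y i p)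
    (h0 : ∀ i, DifferentiableAt ℝ (Y i) p) (hNY : ∀ᶠ p' in 𝓝 p, N (Y 0 p') = -Y 1 p') :
    ∃ s : ℝ, N (Y 3 p) = -Y 2 p + s • Y 0 p ∧ N (Y 2 p) = Y 3 p - s • Y 1 p ∧
      ∀ v, conn Y p v 2 0 - conn Y p v 3 1 = s * conn Y p v 0 0 ∧
        conn Y p v 3 0 + conn Y p v 2 1 = s * conn Y p v 1 0 := by
  have n0 : N (Y 0 p) = -Y 1 p := hNY.self_of_nhds
  have n1 : N (Y 1 p) = Y 0 p := by
    have := hN.sq (Y 0 p)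
    rw [n0, map_neg] at this
    exact neg_injective this
  have a13 := hs.om13
  have a03 := hs.om03
  have a12 := hs.om12
  have a23 := hs.om23
  have n33 : Om (N (Y 3 p)) (Y 3 p) = 0 := by
    have h1 := hN.adj (Y 3 p) (Y 3 p)
    have h2 := Om_swap (Y 3 p) (N (Y 3 p))
    linarith
  have n30 : Om (N (Y 3 p)) (Y 0 p) = 1 := by
    rw [hN.adj, n0, Om_neg_right, Om_swap, a13, neg_neg]
  have n31 : Om (N (Y 3 p)) (Y 1 p) = 0 := by
    rw [hN.adj, n1, Om_swap, a03, neg_zero]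
  have n3 : N (Y 3 p) = -Y 2 p + Om (N (Y 3 p)) (Y 2 p) • Y 0 p := by
    conv_lhs => rw [hs.expand (N (Y 3 p))]
    simp only [n33, n30, n31]
    module
  set s := Om (N (Y 3 p)) (Y 2 p)
  have n2 : N (Y 2 p) = Y 3 p - s • Y 1 p := by
    have h1 := hN.sq (Y 3 p)
    rw [n3, map_add, map_neg, map_smul, n0] at h1
    have : N (Y 2 p) = s • -Y 1 p - (- N (Y 2 p) + s • -Y 1 p) := by module
    rw [this, h1]
    module
  have hD : ∀ v, fderiv ℝ (Y 1) p v = -N (fderiv ℝ (Y 0) p v) := by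
    intro v
    have e : Y 1 =ᶠ[𝓝 p] fun p' => -(N.toContinuousLinearMap (Y 0 p')) := by
      filter_upwards [hNY] with p' hp
      simp [hp]
    rw [e.fderiv_eq]
    have := (N.toContinuousLinearMap.hasFDerivAt.comp p (h0 0).hasFDerivAt).neg.fderiv
    change fderiv ℝ (fun p' => -(N.toContinuousLinearMap (Y 0 p'))) p = _ at this
    rw [this]
    simp
  refine ⟨s, n3, n2, fun v => ⟨?_, ?_⟩⟩
  · have : Om (Y 3 p) (fderiv ℝ (Y 1) p v)
        = -Om (-Y 2 p + s • Y 0 p) (fderiv ℝ (Y 0) p v) := by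
      rw [hD, Om_neg_right, ← hN.adj, n3]
    simp only [conn]
    rw [this, Om_add_left, Om_neg_left, Om_smul_left]
    ring
  · have : Om (Y 2 p) (fderiv ℝ (Y 1) p v)
        = -Om (Y 3 p - s • Y 1 p) (fderiv ℝ (Y 0) p v) := by
      rw [hD, Om_neg_right, ← hN.adj, n2]
    simp only [conn]
    rw [this, Om_sub_left, Om_smul_left]
    ring

/-- A frame adapted to a constant complex structure `N` is unitary for `N`, and has `η = 0`, as
soon as it is of third order. -/
lemma unitary_of_adapted {N : R4 →ₗ[ℝ] R4} (hN : IsOmComplex N)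
    (hs : IsSymplecticBasis fun i => Y i p)
    (h0 : ∀ i, DifferentiableAt ℝ (Y i) p) (hNY : ∀ᶠ p' in 𝓝 p, N (Y 0 p') = -Y 1 p')
    (hdet : conn Y p 1 0 0 * conn Y p Complex.I 1 0
      - conn Y p Complex.I 0 0 * conn Y p 1 1 0 ≠ 0)
    (h3 : ∃ h : ℂ, ∀ v, (⟨(conn Y p v 3 1 - conn Y p v 2 0) / 2,
      (conn Y p v 3 0 + conn Y p v 2 1) / 2⟩ : ℂ) = h * ⟨conn Y p v 0 0, conn Y p v 1 0⟩) :
    N = cplx (fun i => Y i p) ∧ ∀ v, conn Y p v 2 0 - conn Y p v 3 1 = 0 ∧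
        conn Y p v 3 0 + conn Y p v 2 1 = 0 := by
  obtain ⟨s, n3, n2, hη⟩ := eta_of_adapted hN hs h0 hNY
  obtain ⟨h, hh⟩ := h3
  have e1 := hh 1
  have e2 := hh Complex.I
  rw [Complex.ext_iff] at e1 e2
  simp only [Complex.mul_re, Complex.mul_im] at e1 e2
  obtain ⟨a1, b1⟩ := hη 1
  obtain ⟨a2, b2⟩ := hη Complex.I
  have hs0 : s = 0 := by
    refine (mul_eq_zero.1 ?_).resolve_right hdet
    linear_combination -e1.1 * conn Y p Complex.I 1 0 - e1.2 * conn Y p Complex.I 0 0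
      + e2.1 * conn Y p 1 1 0 + e2.2 * conn Y p 1 0 0
      - a1 * conn Y p Complex.I 1 0 / 2 + b1 * conn Y p Complex.I 0 0 / 2
      + a2 * conn Y p 1 1 0 / 2 - b2 * conn Y p 1 0 0 / 2
  subst hs0
  have n0 : N (Y 0 p) = -Y 1 p := hNY.self_of_nhds
  have n1 : N (Y 1 p) = Y 0 p := by
    have := hN.sq (Y 0 p)
    rw [n0, map_neg] at this
    exact neg_injective this
  refine ⟨hs.eq_cplx n0 n1 (by simpa using n2) (by simpa using n3), fun v => ?_⟩
  simpa using hη v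

end Frame

/-! ### The cubic form of a Lagrangian immersion -/

/-- The cubic form `Om (Dφ a, D²φ (v, b))` of an immersion `φ` of the plane, which is symmetric when
`φ` is Lagrangian. -/
def cubic (φ : ℂ → R4) (p a b v : ℂ) : ℝ :=
  Om (fderiv ℝ φ p a) (fderiv ℝ (fderiv ℝ φ) p v b)

/-- The Hessian covariant of the cubic form, i.e. `-γ¹₁ γ²₂ + (γ²₁)²` computed on the coordinate
vectors `∂φ/∂x`, `∂φ/∂y`. -/
def hess (φ : ℂ → R4) (p v : ℂ) : ℝ :=
  cubic φ p 1 Complex.I v ^ 2 - cubic φ p 1 1 v * cubic φ p Complex.I Complex.I v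

section Cubic

variable {φ : ℂ → R4} {p : ℂ}

lemma cubic_symm_right (hφ : ContDiffAt ℝ 2 φ p) (a b v : ℂ) :
    cubic φ p a b v = cubic φ p a v b := by
  rw [cubic, sndDeriv_symm hφ, cubic]

lemma cubic_symm_left (hφ : ContDiffAt ℝ 2 φ p)
    (hL : ∀ᶠ p' in 𝓝 p, ∀ a b, Om (fderiv ℝ φ p' a) (fderiv ℝ φ p' b) = 0) (a b v : ℂ) :
    cubic φ p a b v = cubic φ p b a v := by
  have e : (fun p' => Om (fderiv ℝ φ p' a) (fderiv ℝ φ p' b)) =ᶠ[𝓝 p] fun _ => 0 := by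
    filter_upwards [hL] with p' hp using hp a b
  have h := fderiv_Om (differentiableAt_fderiv_apply hφ a) (differentiableAt_fderiv_apply hφ b) v
  rw [e.fderiv_eq, fderiv_fderiv_apply hφ, fderiv_fderiv_apply hφ] at h
  simp only [fderiv_fun_const, Pi.zero_apply, zero_apply] at h
  rw [cubic, cubic, Om_swap (fderiv ℝ φ p b)]
  linarith

lemma cubic_left (a b v : ℂ) :
    cubic φ p a b v = a.re * cubic φ p 1 b v + a.im * cubic φ p Complex.I b v := by
  conv_lhs => rw [re_im_smul a]
  simp only [cubic, map_add, map_smul, Om_add_left, Om_smul_left]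

lemma cubic_mid (a b v : ℂ) :
    cubic φ p a b v = b.re * cubic φ p a 1 v + b.im * cubic φ p a Complex.I v := by
  conv_lhs => rw [re_im_smul b]
  simp only [cubic, map_add, map_smul, Om_add_right, Om_smul_right]

lemma cubic_right (a b v : ℂ) :
    cubic φ p a b v = v.re * cubic φ p a b 1 + v.im * cubic φ p a b Complex.I := by
  conv_lhs => rw [re_im_smul v]
  simp only [cubic, map_add, map_smul, Om_add_right, Om_smul_right, add_apply, smul_apply]

lemma cubic_expand (hφ : ContDiffAt ℝ 2 φ p)
    (hL : ∀ᶠ p' in 𝓝 p, ∀ a b, Om (fderiv ℝ φ p' a) (fderiv ℝ φ p' b) = 0) (a b v : ℂ) :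
    cubic φ p a b v = a.re * b.re * v.re * cubic φ p 1 1 1
      + (a.re * b.re * v.im + a.re * b.im * v.re + a.im * b.re * v.re) * cubic φ p 1 1 Complex.I
      + (a.re * b.im * v.im + a.im * b.re * v.im + a.im * b.im * v.re)
        * cubic φ p 1 Complex.I Complex.I
      + a.im * b.im * v.im * cubic φ p Complex.I Complex.I Complex.I := by
  rw [cubic_left, cubic_mid 1, cubic_mid Complex.I, cubic_right 1 1, cubic_right 1 Complex.I,
    cubic_right Complex.I 1, cubic_right Complex.I Complex.I,
    cubic_symm_left hφ hL Complex.I 1, cubic_symm_left hφ hL Complex.I 1,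
    cubic_symm_right hφ Complex.I Complex.I 1, cubic_symm_left hφ hL Complex.I 1,
    cubic_symm_right hφ 1 Complex.I 1]
  ring

lemma cubic_sq_sub (hφ : ContDiffAt ℝ 2 φ p)
    (hL : ∀ᶠ p' in 𝓝 p, ∀ a b, Om (fderiv ℝ φ p' a) (fderiv ℝ φ p' b) = 0) (a b v : ℂ) :
    cubic φ p a b v ^ 2 - cubic φ p a a v * cubic φ p b b v = area a b ^ 2 * hess φ p v := by
  simp only [hess, area, cubic_expand hφ hL a, cubic_expand hφ hL b, cubic_expand hφ hL 1 _ v,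
    cubic_expand hφ hL Complex.I Complex.I v]
  simp
  ring

/-- The coefficients `γ` of a frame in terms of the cubic form. Only the tangency of the frame near
the point is used. -/
lemma conn_eq_cubic {Y : Fin 4 → ℂ → R4} {i j : Fin 4} {a b : ℂ} (hφ : ContDiffAt ℝ 2 φ p)
    (hL : ∀ᶠ p' in 𝓝 p, ∀ a b, Om (fderiv ℝ φ p' a) (fderiv ℝ φ p' b) = 0)
    (hY : DifferentiableAt ℝ (Y j) p) (ht : ∀ᶠ p' in 𝓝 p, ∃ w, fderiv ℝ φ p' w = Y j p')
    (ha : fderiv ℝ φ p a = Y i p) (hb : fderiv ℝ φ p b = Y j p) (v : ℂ) :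
    conn Y p v i j = cubic φ p a b v := by
  have e : (fun p' => Om (fderiv ℝ φ p' a) (Y j p')) =ᶠ[𝓝 p] fun _ => 0 := by
    filter_upwards [hL, ht] with p' hp ⟨w, hw⟩
    rw [← hw, hp]
  have h := fderiv_Om (differentiableAt_fderiv_apply hφ a) hY v
  rw [e.fderiv_eq, fderiv_fderiv_apply hφ] at h
  simp only [fderiv_fun_const, Pi.zero_apply, zero_apply] at h
  rw [cubic_symm_left hφ hL, conn, cubic, ← ha, hb, Om_swap (Y j p)]
  linarith

/-- The Gauss plane is a complex line for `N` with respect to one conformal frame, hence with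
respect to every conformal frame. -/
lemma adapted_of_adapted {N : R4 →ₗ[ℝ] R4} (hφ : ContDiffAt ℝ 2 φ p)
    (hL : ∀ᶠ p' in 𝓝 p, ∀ a b, Om (fderiv ℝ φ p' a) (fderiv ℝ φ p' b) = 0)
    (hpos : ∀ v, v ≠ 0 → 0 < hess φ p v) {y₀ y₁ w₀ w₁ : ℂ} (hy : area y₀ y₁ < 0)
    (hw : area w₀ w₁ < 0) (hcy : ∀ v, cubic φ p y₀ y₀ v + cubic φ p y₁ y₁ v = 0)
    (hcw : ∀ v, cubic φ p w₀ w₀ v + cubic φ p w₁ w₁ v = 0)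
    (h0 : N (fderiv ℝ φ p y₀) = -fderiv ℝ φ p y₁) (h1 : N (fderiv ℝ φ p y₁) = fderiv ℝ φ p y₀) :
    N (fderiv ℝ φ p w₀) = -fderiv ℝ φ p w₁ := by
  obtain ⟨k, hk⟩ : ∃ k, k = (area y₀ y₁)⁻¹ := ⟨_, rfl⟩
  have hkA : k * area y₀ y₁ = 1 := by rw [hk]; exact inv_mul_cancel₀ hy.ne
  have cramer : ∀ w : ℂ, w = (k * area w y₁) • y₀ + (k * area y₀ w) • y₁ := by
    intro w
    apply Complex.ext
    · simp only [Complex.add_re, Complex.smul_re, smul_eq_mul]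
      unfold area at hkA ⊢
      linear_combination -w.re * hkA
    · simp only [Complex.add_im, Complex.smul_im, smul_eq_mul]
      unfold area at hkA ⊢
      linear_combination -w.im * hkA
  obtain ⟨m, n, hw0⟩ : ∃ m n : ℝ, w₀ = m • y₀ + n • y₁ := ⟨_, _, cramer w₀⟩
  obtain ⟨r, s, hw1⟩ : ∃ r s : ℝ, w₁ = r • y₀ + s • y₁ := ⟨_, _, cramer w₁⟩
  have hdet : cubic φ p y₀ y₀ 1 * cubic φ p y₀ y₁ Complex.I
      - cubic φ p y₀ y₀ Complex.I * cubic φ p y₀ y₁ 1 ≠ 0 := by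
    apply det_ne_zero_of_sq_add_sq_pos
    intro x y hxy
    have hv : (⟨x, y⟩ : ℂ) ≠ 0 := by
      intro h
      rw [Complex.ext_iff] at h
      simp only [Complex.zero_re, Complex.zero_im] at h
      tauto
    have h := mul_pos (pow_pos (neg_pos.2 hy) 2) (hpos _ hv)
    rw [neg_sq, ← cubic_sq_sub hφ hL, eq_neg_of_add_eq_zero_right (hcy _),
      cubic_right y₀ y₀, cubic_right y₀ y₁] at h
    simp only at h
    linarith
  have hexp : ∀ v, (m ^ 2 + r ^ 2 - n ^ 2 - s ^ 2) * cubic φ p y₀ y₀ v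
      + 2 * (m * n + r * s) * cubic φ p y₀ y₁ v = 0 := by
    intro v
    have h := hcw v
    have hc := hcy v
    rw [hw0, hw1] at h
    rw [cubic_expand hφ hL] at h hc
    rw [cubic_expand hφ hL _ _ v] at h hc
    rw [cubic_expand hφ hL y₀ y₀, cubic_expand hφ hL y₀ y₁]
    simp only [Complex.add_re, Complex.add_im, Complex.smul_re,
      Complex.smul_im, smul_eq_mul] at h hc ⊢
    linear_combination h - (n ^ 2 + s ^ 2) * hc
  have e1 := hexp 1
  have eI := hexp Complex.I
  have z1 : m ^ 2 + r ^ 2 - n ^ 2 - s ^ 2 = 0 := by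
    refine (mul_eq_zero.1 ?_).resolve_right hdet
    linear_combination cubic φ p y₀ y₁ Complex.I * e1 - cubic φ p y₀ y₁ 1 * eI
  have z2 : m * n + r * s = 0 := by
    refine (mul_eq_zero.1 ?_).resolve_right hdet
    linear_combination (-cubic φ p y₀ y₀ Complex.I * e1 + cubic φ p y₀ y₀ 1 * eI) / 2
  have hd : 0 < m * s - n * r := by
    have : area w₀ w₁ = (m * s - n * r) * area y₀ y₁ := by
      rw [hw0, hw1]; simp [area]; ring
    rw [this] at hw
    exact pos_of_mul_neg_left hw hy.le
  have z3 : m * s - n * r = m ^ 2 + r ^ 2 := by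
    have : (m * s - n * r) ^ 2 = (m ^ 2 + r ^ 2) ^ 2 := by
      linear_combination -(m ^ 2 + r ^ 2) * z1 - (m * n + r * s) * z2
    exact (pow_left_inj₀ hd.le (by positivity) two_ne_zero).1 this
  have z4 : (m - s) ^ 2 + (n + r) ^ 2 = 0 := by linear_combination -z1 - 2 * z3
  have hs : s = m := by nlinarith [sq_nonneg (m - s), sq_nonneg (n + r)]
  have hr : r = -n := by nlinarith [sq_nonneg (m - s), sq_nonneg (n + r)]
  rw [hw0, hw1, hs, hr]
  simp only [map_add, map_smul, h0, h1]
  module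

end Cubic

/-! ### First order frames in a coordinate domain -/

lemma two_le_infty : (2 : WithTop ℕ∞) ≤ ∞ := ENat.LEInfty.out

/-- A symplectic frame field `Y` along a Lagrangian map `φ` of the open set `V` of the plane whose
first two vectors span the tangent planes. -/
structure IsPlaneFrame (φ : ℂ → R4) (V : Set ℂ) (Y : Fin 4 → ℂ → R4) : Prop where
  isOpen : IsOpen V
  smooth_map : ContDiffOn ℝ ∞ φ V
  lagrangian : ∀ p ∈ V, ∀ a b, Om (fderiv ℝ φ p a) (fderiv ℝ φ p b) = 0
  smooth : ∀ j, ContDiffOn ℝ ∞ (Y j) V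
  symplectic : ∀ p ∈ V, IsSymplecticBasis fun i => Y i p
  tangent : ∀ p ∈ V, ∃ w₀ w₁, area w₀ w₁ ≠ 0 ∧ fderiv ℝ φ p w₀ = Y 0 p ∧ fderiv ℝ φ p w₁ = Y 1 p

namespace IsPlaneFrame

variable {φ : ℂ → R4} {V : Set ℂ} {Y : Fin 4 → ℂ → R4} (h : IsPlaneFrame φ V Y) {p : ℂ}
include h

lemma contDiffAt (hp : p ∈ V) (i : Fin 4) : ContDiffAt ℝ 2 (Y i) p :=
  ((h.smooth i).contDiffAt (h.isOpen.mem_nhds hp)).of_le two_le_infty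

lemma contDiffAt_map (hp : p ∈ V) : ContDiffAt ℝ 2 φ p :=
  (h.smooth_map.contDiffAt (h.isOpen.mem_nhds hp)).of_le two_le_infty

lemma differentiableAt (hp : p ∈ V) (i : Fin 4) : DifferentiableAt ℝ (Y i) p :=
  (h.contDiffAt hp i).differentiableAt (by norm_num)

lemma eventually_symplectic (hp : p ∈ V) : ∀ᶠ p' in 𝓝 p, IsSymplecticBasis fun i => Y i p' := by
  filter_upwards [h.isOpen.mem_nhds hp] with p' hp' using h.symplectic p' hp'

lemma eventually_lagrangian (hp : p ∈ V) :
    ∀ᶠ p' in 𝓝 p, ∀ a b, Om (fderiv ℝ φ p' a) (fderiv ℝ φ p' b) = 0 := by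
  filter_upwards [h.isOpen.mem_nhds hp] with p' hp' using h.lagrangian p' hp'

lemma gamma_eq_cubic (hp : p ∈ V) {w₀ w₁ : ℂ} (h0 : fderiv ℝ φ p w₀ = Y 0 p)
    (h1 : fderiv ℝ φ p w₁ = Y 1 p) (v : ℂ) : conn Y p v 0 0 = cubic φ p w₀ w₀ v ∧
      conn Y p v 1 0 = cubic φ p w₀ w₁ v ∧ conn Y p v 1 1 = cubic φ p w₁ w₁ v := by
  have hφ := h.contDiffAt_map hp
  have hL := h.eventually_lagrangian hp
  have t0 : ∀ᶠ p' in 𝓝 p, ∃ w, fderiv ℝ φ p' w = Y 0 p' := by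
    filter_upwards [h.isOpen.mem_nhds hp] with p' hp'
    obtain ⟨w, -, -, hw, -⟩ := h.tangent p' hp'
    exact ⟨w, hw⟩
  have t1 : ∀ᶠ p' in 𝓝 p, ∃ w, fderiv ℝ φ p' w = Y 1 p' := by
    filter_upwards [h.isOpen.mem_nhds hp] with p' hp'
    obtain ⟨-, w, -, -, hw⟩ := h.tangent p' hp'
    exact ⟨w, hw⟩
  refine ⟨conn_eq_cubic hφ hL (h.differentiableAt hp 0) t0 h0 h0 v, ?_,
    conn_eq_cubic hφ hL (h.differentiableAt hp 1) t1 h1 h1 v⟩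
  rw [cubic_symm_left hφ hL]
  exact conn_eq_cubic hφ hL (h.differentiableAt hp 0) t0 h1 h0 v

lemma gauss_eq_hess (hp : p ∈ V) {w₀ w₁ : ℂ} (h0 : fderiv ℝ φ p w₀ = Y 0 p)
    (h1 : fderiv ℝ φ p w₁ = Y 1 p) (v : ℂ) :
    -(conn Y p v 0 0 * conn Y p v 1 1) + conn Y p v 1 0 ^ 2 = area w₀ w₁ ^ 2 * hess φ p v := by
  obtain ⟨e1, e2, e3⟩ := h.gamma_eq_cubic hp h0 h1 v
  rw [← cubic_sq_sub (h.contDiffAt_map hp) (h.eventually_lagrangian hp), e1, e2, e3]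
  ring

/-- For second order frames along an elliptic surface, the form `ω` is a coframe. -/
lemma omega_det_ne_zero (hp : p ∈ V) (h2 : ∀ v, conn Y p v 0 0 + conn Y p v 1 1 = 0)
    (hpos : ∀ v, v ≠ 0 → 0 < hess φ p v) :
    conn Y p 1 0 0 * conn Y p Complex.I 1 0 - conn Y p Complex.I 0 0 * conn Y p 1 1 0 ≠ 0 := by
  obtain ⟨w₀, w₁, hw, h0, h1⟩ := h.tangent p hp
  apply det_ne_zero_of_sq_add_sq_pos
  intro x y hxy
  have hv : (⟨x, y⟩ : ℂ) ≠ 0 := by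
    intro h
    rw [Complex.ext_iff] at h
    simp only [Complex.zero_re, Complex.zero_im] at h
    tauto
  have hh := mul_pos (pow_pos (abs_pos.2 hw) 2) (hpos _ hv)
  rw [sq_abs, ← h.gauss_eq_hess hp h0 h1, eq_neg_of_add_eq_zero_right (h2 _),
    conn_re_im Y p _ 0 0, conn_re_im Y p _ 1 0] at hh
  simp only at hh
  linarith

end IsPlaneFrame

/-! ### Existence of third order frames -/

/-- A Euclidean completion of a Lagrangian basis to a symplectic basis: `Om (x, K y) = x ⬝ y` for
`K = -J`, and the dual basis is obtained from `K y₀, K y₁` with the inverse Gram matrix. -/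
lemma exists_symplectic_completion {V : Set ℂ} {Y₀ Y₁ : ℂ → R4} (h0 : ContDiffOn ℝ ∞ Y₀ V)
    (h1 : ContDiffOn ℝ ∞ Y₁ V) (hL : ∀ p ∈ V, Om (Y₀ p) (Y₁ p) = 0)
    (hI : ∀ p ∈ V, ∀ a b : ℝ, a • Y₀ p + b • Y₁ p = 0 → a = 0 ∧ b = 0) :
    ∃ Y₂ Y₃ : ℂ → R4, ContDiffOn ℝ ∞ Y₂ V ∧ ContDiffOn ℝ ∞ Y₃ V ∧
      ∀ p ∈ V, IsSymplecticBasis ![Y₀ p, Y₁ p, Y₂ p, Y₃ p] := by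
  set K : R4 →L[ℝ] R4 := (Matrix.toLin' (-J)).toContinuousLinearMap with hK
  have hKapp : ∀ x : R4, K x = ![-x 2, -x 3, x 0, x 1] := by
    intro x
    ext i
    fin_cases i <;>
      simp [K, J, Matrix.mulVec, dotProduct, Fin.sum_univ_four]
  have hdot : ∀ x y : R4, Om x (K y) = x 0 * y 0 + x 1 * y 1 + x 2 * y 2 + x 3 * y 3 := by
    intro x y
    rw [hKapp, Om_eq]
    simp
  have hKK : ∀ x y : R4, Om (K x) (K y) = Om x y := by
    intro x y
    rw [hKapp, hKapp, Om_eq, Om_eq]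
    simp
    ring
  have hsym : ∀ x y : R4, Om x (K y) = Om y (K x) := by
    intro x y
    rw [hdot, hdot]
    ring
  have hpos : ∀ x : R4, x ≠ 0 → 0 < Om x (K x) := by
    intro x hx
    rw [hdot]
    by_contra hn
    apply hx
    have := mul_self_nonneg (x 0)
    have := mul_self_nonneg (x 1)
    have := mul_self_nonneg (x 2)
    have := mul_self_nonneg (x 3)
    ext i
    fin_cases i <;> simp <;> nlinarith
  have hD : ∀ p ∈ V, Om (Y₀ p) (K (Y₀ p)) * Om (Y₁ p) (K (Y₁ p)) - Om (Y₀ p) (K (Y₁ p)) ^ 2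
      ≠ 0 := by
    intro p hp hzero
    have ha : 0 < Om (Y₀ p) (K (Y₀ p)) := by
      apply hpos
      intro hz
      have := hI p hp 1 0 (by simp [hz])
      norm_num at this
    have hne : -Om (Y₀ p) (K (Y₁ p)) • Y₀ p + Om (Y₀ p) (K (Y₀ p)) • Y₁ p ≠ 0 :=
      fun hz => ha.ne' (hI p hp _ _ hz).2
    have hh := hpos _ hne
    simp only [map_add, map_smul, Om_add_left, Om_smul_left, Om_add_right, Om_smul_right,
      hsym (Y₁ p) (Y₀ p)] at hh
    have : Om (Y₀ p) (K (Y₀ p)) *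
      (Om (Y₀ p) (K (Y₀ p)) * Om (Y₁ p) (K (Y₁ p)) - Om (Y₀ p) (K (Y₁ p)) ^ 2) > 0 := by
      linarith
    rw [hzero, mul_zero] at this
    exact lt_irrefl _ this
  have sK0 : ContDiffOn ℝ ∞ (fun p => K (Y₀ p)) V := K.contDiff.comp_contDiffOn h0
  have sK1 : ContDiffOn ℝ ∞ (fun p => K (Y₁ p)) V := K.contDiff.comp_contDiffOn h1
  have sa := contDiffOn_Om h0 sK0
  have sb := contDiffOn_Om h0 sK1
  have sc := contDiffOn_Om h1 sK1
  have sD := ((sa.mul sc).sub (sb.pow 2)).inv hD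
  refine ⟨fun p => (Om (Y₀ p) (K (Y₀ p)) * Om (Y₁ p) (K (Y₁ p)) - Om (Y₀ p) (K (Y₁ p)) ^ 2)⁻¹ •
      (Om (Y₁ p) (K (Y₁ p)) • K (Y₀ p) - Om (Y₀ p) (K (Y₁ p)) • K (Y₁ p)),
    fun p => (Om (Y₀ p) (K (Y₀ p)) * Om (Y₁ p) (K (Y₁ p)) - Om (Y₀ p) (K (Y₁ p)) ^ 2)⁻¹ •
      (Om (Y₀ p) (K (Y₀ p)) • K (Y₁ p) - Om (Y₀ p) (K (Y₁ p)) • K (Y₀ p)),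
    sD.smul ((sc.smul sK0).sub (sb.smul sK1)), sD.smul ((sa.smul sK1).sub (sb.smul sK0)), ?_⟩
  intro p hp
  have hd := hD p hp
  have e := hsym (Y₁ p) (Y₀ p)
  have l := hL p hp
  apply isSymplecticBasis_of
  · simpa using l
  all_goals
    simp [Om_smul_left, Om_smul_right, Om_sub_left, Om_sub_right, hKK, Om_self, e, l,
      Om_swap (Y₁ p) (Y₀ p)]
    try first | (right; ring) | (field_simp; try ring)

/-- Around every point of an elliptic Lagrangian surface there is a second order frame: its tangent
vectors are orthogonal, and of equal length, for the conformal structure given by `hess`, because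
the cubic form is apolar to its Hessian. -/
lemma exists_second_order_frame {φ : ℂ → R4} {V : Set ℂ} (hV : IsOpen V) (hφ : ContDiffOn ℝ ∞ φ V)
    (hL : ∀ p ∈ V, ∀ a b, Om (fderiv ℝ φ p a) (fderiv ℝ φ p b) = 0)
    (hI : ∀ p ∈ V, Function.Injective (fderiv ℝ φ p))
    (hpos : ∀ p ∈ V, ∀ v, v ≠ 0 → 0 < hess φ p v) :
    ∃ Y, IsPlaneFrame φ V Y ∧ (∀ p ∈ V, ∀ v, conn Y p v 0 0 + conn Y p v 1 1 = 0) ∧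
      ∀ p ∈ V, ∃ w₀ w₁, area w₀ w₁ < 0 ∧ fderiv ℝ φ p w₀ = Y 0 p ∧ fderiv ℝ φ p w₁ = Y 1 p := by
  have hφ2 : ∀ p ∈ V, ContDiffAt ℝ 2 φ p := fun p hp =>
    (hφ.contDiffAt (hV.mem_nhds hp)).of_le two_le_infty
  have hLe : ∀ p ∈ V, ∀ᶠ p' in 𝓝 p, ∀ a b, Om (fderiv ℝ φ p' a) (fderiv ℝ φ p' b) = 0 := by
    intro p hp
    filter_upwards [hV.mem_nhds hp] with p' hp' using hL p' hp'
  have s1 : ContDiffOn ℝ ∞ (fderiv ℝ φ) V := hφ.fderiv_of_isOpen hV (by simp)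
  have s2 : ContDiffOn ℝ ∞ (fderiv ℝ (fderiv ℝ φ)) V := s1.fderiv_of_isOpen hV (by simp)
  have s1v : ∀ a : ℂ, ContDiffOn ℝ ∞ (fun p => fderiv ℝ φ p a) V := fun a =>
    s1.clm_apply contDiffOn_const
  have s2v : ∀ a v : ℂ, ContDiffOn ℝ ∞ (fun p => fderiv ℝ (fderiv ℝ φ) p v a) V := fun a v =>
    (s2.clm_apply contDiffOn_const).clm_apply contDiffOn_const
  have sc : ∀ a b v : ℂ, ContDiffOn ℝ ∞ (fun p => cubic φ p a b v) V := fun a b v =>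
    contDiffOn_Om (s1v a) (s2v b v)
  obtain ⟨c₀, hc₀⟩ : ∃ c, c = fun p => cubic φ p 1 1 1 := ⟨_, rfl⟩
  obtain ⟨c₁, hc₁⟩ : ∃ c, c = fun p => cubic φ p 1 1 Complex.I := ⟨_, rfl⟩
  obtain ⟨c₂, hc₂⟩ : ∃ c, c = fun p => cubic φ p 1 Complex.I Complex.I := ⟨_, rfl⟩
  obtain ⟨c₃, hc₃⟩ : ∃ c, c = fun p => cubic φ p Complex.I Complex.I Complex.I := ⟨_, rfl⟩
  have sc0 : ContDiffOn ℝ ∞ c₀ V := hc₀ ▸ sc _ _ _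
  have sc1 : ContDiffOn ℝ ∞ c₁ V := hc₁ ▸ sc _ _ _
  have sc2 : ContDiffOn ℝ ∞ c₂ V := hc₂ ▸ sc _ _ _
  have sc3 : ContDiffOn ℝ ∞ c₃ V := hc₃ ▸ sc _ _ _
  have hexp : ∀ p ∈ V, ∀ a b v : ℂ, cubic φ p a b v = a.re * b.re * v.re * c₀ p
      + (a.re * b.re * v.im + a.re * b.im * v.re + a.im * b.re * v.re) * c₁ p
      + (a.re * b.im * v.im + a.im * b.re * v.im + a.im * b.im * v.re) * c₂ p
      + a.im * b.im * v.im * c₃ p := by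
    intro p hp a b v
    rw [hc₀, hc₁, hc₂, hc₃]
    exact cubic_expand (hφ2 p hp) (hLe p hp) a b v
  -- The Hessian is `E x² + 2 F x y + G y²`.
  set E : ℂ → ℝ := fun p => c₁ p ^ 2 - c₀ p * c₂ p with hE
  set F : ℂ → ℝ := fun p => (c₁ p * c₂ p - c₀ p * c₃ p) / 2 with hF
  set G : ℂ → ℝ := fun p => c₂ p ^ 2 - c₁ p * c₃ p with hG
  have hhess : ∀ p ∈ V, ∀ v, hess φ p v = E p * v.re ^ 2 + 2 * F p * v.re * v.im
      + G p * v.im ^ 2 := by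
    intro p hp v
    simp only [hess, hexp p hp, hE, hF, hG]
    simp
    ring
  have hEpos : ∀ p ∈ V, 0 < E p := by
    intro p hp
    have := hpos p hp 1 one_ne_zero
    rw [hhess p hp] at this
    simpa using this
  have hΔ : ∀ p ∈ V, 0 < E p * G p - F p ^ 2 := by
    intro p hp
    have hE0 := hEpos p hp
    have := hpos p hp ⟨F p, -E p⟩ (by
      intro h
      rw [Complex.ext_iff] at h
      simp only [Complex.zero_im, neg_eq_zero] at h
      exact hE0.ne' h.2)
    rw [hhess p hp] at this
    simp only at this
    have e : E p * F p ^ 2 + 2 * F p * F p * -E p + G p * (-E p) ^ 2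
        = E p * (E p * G p - F p ^ 2) := by ring
    rw [e] at this
    exact (mul_pos_iff_of_pos_left hE0).1 this
  have sE : ContDiffOn ℝ ∞ E V := (sc1.pow 2).sub (sc0.mul sc2)
  have sF : ContDiffOn ℝ ∞ F V := ((sc1.mul sc2).sub (sc0.mul sc3)).div_const 2
  have sG : ContDiffOn ℝ ∞ G V := (sc2.pow 2).sub (sc1.mul sc3)
  set R : ℂ → ℝ := fun p => (√(E p * G p - F p ^ 2))⁻¹ with hR
  have sR : ContDiffOn ℝ ∞ R V :=
    (((sE.mul sG).sub (sF.pow 2)).sqrt fun p hp => (hΔ p hp).ne').inv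
      fun p hp => (Real.sqrt_pos.2 (hΔ p hp)).ne'
  have hRpos : ∀ p ∈ V, 0 < R p := fun p hp => inv_pos.2 (Real.sqrt_pos.2 (hΔ p hp))
  have hRsq : ∀ p ∈ V, R p ^ 2 * (E p * G p - F p ^ 2) = 1 := by
    intro p hp
    rw [hR]
    simp only [inv_pow]
    rw [Real.sq_sqrt (hΔ p hp).le]
    exact inv_mul_cancel₀ (hΔ p hp).ne'
  set Y₀ : ℂ → R4 := fun p => fderiv ℝ φ p 1 with hY₀
  set Y₁ : ℂ → R4 := fun p => (R p * F p) • fderiv ℝ φ p 1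
    - (R p * E p) • fderiv ℝ φ p Complex.I with hY₁
  have sY₁ : ContDiffOn ℝ ∞ Y₁ V :=
    ((sR.mul sF).smul (s1v 1)).sub ((sR.mul sE).smul (s1v Complex.I))
  have hw : ∀ p, fderiv ℝ φ p ⟨R p * F p, -(R p * E p)⟩ = Y₁ p := by
    intro p
    rw [re_im_smul ⟨R p * F p, -(R p * E p)⟩]
    simp only [map_add, map_smul, hY₁]
    module
  have harea : ∀ p ∈ V, area 1 ⟨R p * F p, -(R p * E p)⟩ < 0 := by
    intro p hp
    simp only [area, Complex.one_re, Complex.one_im, one_mul, zero_mul, sub_zero]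
    exact neg_lt_zero.2 (mul_pos (hRpos p hp) (hEpos p hp))
  have hind : ∀ p ∈ V, ∀ a b : ℝ, a • Y₀ p + b • Y₁ p = 0 → a = 0 ∧ b = 0 := by
    intro p hp a b hab
    rw [← hw, hY₀] at hab
    simp only [← map_smul, ← map_add] at hab
    have := hI p hp (hab.trans (map_zero _).symm)
    rw [Complex.ext_iff] at this
    simp at this
    have hb : b = 0 := by
      have h3 : R p * E p ≠ 0 := (mul_pos (hRpos p hp) (hEpos p hp)).ne'
      rcases this.2 with h | h | h
      · exact h
      · exact absurd h (hRpos p hp).ne'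
      · exact absurd h (hEpos p hp).ne'
    refine ⟨?_, hb⟩
    simpa [hb] using this.1
  obtain ⟨Y₂, Y₃, sY₂, sY₃, hsymp⟩ := exists_symplectic_completion (s1v 1) sY₁
    (fun p hp => by rw [← hw]; exact hL p hp _ _) hind
  have hfr : IsPlaneFrame φ V ![Y₀, Y₁, Y₂, Y₃] := by
    refine ⟨hV, hφ, hL, ?_, ?_, ?_⟩
    · intro j
      fin_cases j
      · exact s1v 1
      · exact sY₁
      · exact sY₂
      · exact sY₃
    · intro p hp
      convert hsymp p hp using 1
      ext i
      fin_cases i <;> rfl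
    · exact fun p hp => ⟨1, _, (harea p hp).ne, rfl, hw p⟩
  refine ⟨_, hfr, ?_, fun p hp => ⟨1, _, harea p hp, rfl, hw p⟩⟩
  intro p hp v
  obtain ⟨e1, -, e3⟩ := hfr.gamma_eq_cubic hp (w₀ := 1) rfl (hw p) v
  rw [e1, e3, hexp p hp, hexp p hp]
  have hr := hRsq p hp
  simp only [Complex.one_re, Complex.one_im]
  have hEG : ∀ x y : ℝ, x * c₀ p + y * c₁ p + R p ^ 2 * (F p ^ 2 * (x * c₀ p + y * c₁ p)
      - 2 * F p * E p * (x * c₁ p + y * c₂ p) + E p ^ 2 * (x * c₂ p + y * c₃ p)) = 0 := by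
    intro x y
    simp only [hE, hF, hG] at hr ⊢
    linear_combination -(x * c₀ p + y * c₁ p) * hr
  linear_combination hEG v.re v.im

/-- Around every point of an elliptic Lagrangian surface there is a third order frame. -/
lemma exists_third_order_plane_frame {φ : ℂ → R4} {V : Set ℂ} (hV : IsOpen V)
    (hφ : ContDiffOn ℝ ∞ φ V)
    (hL : ∀ p ∈ V, ∀ a b, Om (fderiv ℝ φ p a) (fderiv ℝ φ p b) = 0)
    (hI : ∀ p ∈ V, Function.Injective (fderiv ℝ φ p))
    (hpos : ∀ p ∈ V, ∀ v, v ≠ 0 → 0 < hess φ p v) :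
    ∃ Y, IsPlaneFrame φ V Y ∧ (∀ p ∈ V, ∀ v, conn Y p v 0 0 + conn Y p v 1 1 = 0) ∧
      (∀ p ∈ V, ∃ w₀ w₁, area w₀ w₁ < 0 ∧ fderiv ℝ φ p w₀ = Y 0 p ∧ fderiv ℝ φ p w₁ = Y 1 p) ∧
      ∀ p ∈ V, ∃ h : ℂ, ∀ v, (⟨(conn Y p v 3 1 - conn Y p v 2 0) / 2,
        (conn Y p v 3 0 + conn Y p v 2 1) / 2⟩ : ℂ) = h * ⟨conn Y p v 0 0, conn Y p v 1 0⟩ := by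
  obtain ⟨Y, hY, h2, hw⟩ := exists_second_order_frame hV hφ hL hI hpos
  have sconn : ∀ v i j, ContDiffOn ℝ ∞ (fun p => conn Y p v i j) V := fun v i j =>
    contDiffOn_Om (hY.smooth i)
      (((hY.smooth j).fderiv_of_isOpen hV (by simp)).clm_apply contDiffOn_const)
  have hdet : ∀ p ∈ V, conn Y p 1 0 0 * conn Y p Complex.I 1 0
      - conn Y p Complex.I 0 0 * conn Y p 1 1 0 ≠ 0 := fun p hp =>
    hY.omega_det_ne_zero hp (h2 p hp) (hpos p hp)
  -- `s` is the real coefficient `ℓ` of `η = h ω + ℓ ω̄`; adding `s Y₀` to `Y₂` and `s Y₁` to `Y₃`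
  -- replaces `η` by `η - s ω̄`.
  set s : ℂ → ℝ := fun p => (-(conn Y p 1 2 0 - conn Y p 1 3 1) * conn Y p Complex.I 1 0
    + (conn Y p 1 3 0 + conn Y p 1 2 1) * conn Y p Complex.I 0 0
    + (conn Y p Complex.I 2 0 - conn Y p Complex.I 3 1) * conn Y p 1 1 0
    - (conn Y p Complex.I 3 0 + conn Y p Complex.I 2 1) * conn Y p 1 0 0) *
    (4 * (conn Y p 1 0 0 * conn Y p Complex.I 1 0
      - conn Y p Complex.I 0 0 * conn Y p 1 1 0))⁻¹ with hs
  have ss : ContDiffOn ℝ ∞ s V := by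
    refine ContDiffOn.mul ?_ (ContDiffOn.inv (contDiffOn_const.mul (((sconn _ _ _).mul
      (sconn _ _ _)).sub ((sconn _ _ _).mul (sconn _ _ _))))
      fun p hp => mul_ne_zero four_ne_zero (hdet p hp))
    exact (((((sconn _ _ _).sub (sconn _ _ _)).neg.mul (sconn _ _ _)).add
      (((sconn _ _ _).add (sconn _ _ _)).mul (sconn _ _ _))).add
      (((sconn _ _ _).sub (sconn _ _ _)).mul (sconn _ _ _))).sub
      (((sconn _ _ _).add (sconn _ _ _)).mul (sconn _ _ _))
  set Y' : Fin 4 → ℂ → R4 := ![Y 0, Y 1, fun p => Y 2 p + s p • Y 0 p,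
    fun p => Y 3 p + s p • Y 1 p] with hY'
  have hfr : IsPlaneFrame φ V Y' := by
    refine ⟨hV, hφ, hL, ?_, ?_, hY.tangent⟩
    · intro j
      fin_cases j
      · exact hY.smooth 0
      · exact hY.smooth 1
      · exact (hY.smooth 2).add (ss.smul (hY.smooth 0))
      · exact (hY.smooth 3).add (ss.smul (hY.smooth 1))
    · intro p hp
      have he := hY.symplectic p hp
      have a1 := he.om01
      have a2 := he.om02
      have a3 := he.om03
      have a4 := he.om12
      have a5 := he.om13
      have a6 := he.om23
      apply isSymplecticBasis_of <;>
        simp [Y', Om_add_left, Om_add_right, Om_smul_left, Om_smul_right, Om_self, a1, a2, a3, a4,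
          a5, a6, Om_swap (Y 2 p) (Y 1 p), Om_swap (Y 1 p) (Y 0 p)]
  refine ⟨Y', hfr, h2, hw, fun p hp => ?_⟩
  have hsy := conn_symm (hY.eventually_symplectic hp) (hY.differentiableAt hp)
  have c0 : ∀ v, conn Y' p v 0 0 = conn Y p v 0 0 := fun v => rfl
  have c1 : ∀ v, conn Y' p v 1 0 = conn Y p v 1 0 := fun v => rfl
  have c20 : ∀ v, conn Y' p v 2 0 = conn Y p v 2 0 + s p * conn Y p v 0 0 := fun v => by
    simp only [conn, Y']
    simp [Om_add_left, Om_smul_left]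
  have c30 : ∀ v, conn Y' p v 3 0 = conn Y p v 3 0 + s p * conn Y p v 1 0 := fun v => by
    simp only [conn, Y']
    simp [Om_add_left, Om_smul_left]
  have c21 : ∀ v, conn Y' p v 2 1 = conn Y p v 2 1 + s p * conn Y p v 1 0 := fun v => by
    rw [← hsy v 0 1]
    simp only [conn, Y']
    simp [Om_add_left, Om_smul_left]
  have c31 : ∀ v, conn Y' p v 3 1 = conn Y p v 3 1 - s p * conn Y p v 0 0 := fun v => by
    have : conn Y' p v 3 1 = conn Y p v 3 1 + s p * conn Y p v 1 1 := by
      simp only [conn, Y']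
      simp [Om_add_left, Om_smul_left]
    rw [this, eq_neg_of_add_eq_zero_right (h2 p hp v)]
    ring
  have hrel := trace_gamma_relation (hY.eventually_symplectic hp) (hY.contDiffAt hp)
    (by filter_upwards [hV.mem_nhds hp] with p' hp' using h2 p' hp') 1 Complex.I
  have hsp : s p * (4 * (conn Y p 1 0 0 * conn Y p Complex.I 1 0
      - conn Y p Complex.I 0 0 * conn Y p 1 1 0)) =
      -(conn Y p 1 2 0 - conn Y p 1 3 1) * conn Y p Complex.I 1 0
    + (conn Y p 1 3 0 + conn Y p 1 2 1) * conn Y p Complex.I 0 0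
    + (conn Y p Complex.I 2 0 - conn Y p Complex.I 3 1) * conn Y p 1 1 0
    - (conn Y p Complex.I 3 0 + conn Y p Complex.I 2 1) * conn Y p 1 0 0 := by
    rw [hs]
    exact inv_mul_cancel_right₀ (mul_ne_zero four_ne_zero (hdet p hp)) _
  clear_value s
  have hne : (⟨conn Y p 1 0 0, conn Y p 1 1 0⟩ : ℂ) ≠ 0 := by
    intro hz
    rw [Complex.ext_iff] at hz
    simp only [Complex.zero_re, Complex.zero_im] at hz
    apply hdet p hp
    rw [hz.1, hz.2]
    ring
  have hcross : (⟨(conn Y' p 1 3 1 - conn Y' p 1 2 0) / 2,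
        (conn Y' p 1 3 0 + conn Y' p 1 2 1) / 2⟩ : ℂ) *
        ⟨conn Y p Complex.I 0 0, conn Y p Complex.I 1 0⟩ =
      ⟨(conn Y' p Complex.I 3 1 - conn Y' p Complex.I 2 0) / 2,
        (conn Y' p Complex.I 3 0 + conn Y' p Complex.I 2 1) / 2⟩ *
        ⟨conn Y p 1 0 0, conn Y p 1 1 0⟩ := by
    simp only [c20, c30, c21, c31]
    apply Complex.ext
    · simp only [Complex.mul_re]
      linear_combination hrel / 2
    · simp only [Complex.mul_im]
      linear_combination -hsp / 2
  refine ⟨⟨(conn Y' p 1 3 1 - conn Y' p 1 2 0) / 2, (conn Y' p 1 3 0 + conn Y' p 1 2 1) / 2⟩ /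
    ⟨conn Y p 1 0 0, conn Y p 1 1 0⟩, fun v => ?_⟩
  rw [c0, c1, div_mul_eq_mul_div, eq_div_iff hne]
  rw [conn_re_im Y' p v 3 1, conn_re_im Y' p v 2 0, conn_re_im Y' p v 3 0, conn_re_im Y' p v 2 1,
    conn_re_im Y p v 0 0, conn_re_im Y p v 1 0]
  rw [Complex.ext_iff] at hcross ⊢
  simp only [Complex.mul_re, Complex.mul_im] at hcross ⊢
  constructor
  · linear_combination -v.im * hcross.1
  · linear_combination -v.im * hcross.2

/-! ### From the surface to a coordinate domain -/

lemma area_map (L : ℂ →L[ℝ] ℂ) (a b : ℂ) :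
    area (L a) (L b) = area (L 1) (L Complex.I) * area a b := by
  conv_lhs => rw [re_im_smul a, re_im_smul b]
  simp only [map_add, map_smul]
  simp [area]
  ring

section Surface

variable {M : Type*} [TopologicalSpace M] [ChartedSpace ℂ M]

/-- The differential of a coordinate `z` at `q`. The tangent space at `q` is `ℂ`, through the
preferred chart. -/
def coordDeriv (z : M → ℂ) (q : M) : ℂ →L[ℝ] ℂ := mfderiv 𝓘(ℝ, ℂ) 𝓘(ℝ, ℂ) z q

lemma theta_zero {X : Fin 4 → M → R4} {q : M} (h : IsSymplecticBasis fun i => X i q) (v : ℂ)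
    (j : Fin 4) : theta X q v 0 j = -Om (X 2 q) (dR4 (X j) q v) := by
  exact congrFun (h.inv_mulVec (dR4 (X j) q v)) 0

lemma theta_one {X : Fin 4 → M → R4} {q : M} (h : IsSymplecticBasis fun i => X i q) (v : ℂ)
    (j : Fin 4) : theta X q v 1 j = -Om (X 3 q) (dR4 (X j) q v) := by
  exact congrFun (h.inv_mulVec (dR4 (X j) q v)) 1

lemma theta_two {X : Fin 4 → M → R4} {q : M} (h : IsSymplecticBasis fun i => X i q) (v : ℂ)
    (j : Fin 4) : theta X q v 2 j = Om (X 0 q) (dR4 (X j) q v) := by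
  exact congrFun (h.inv_mulVec (dR4 (X j) q v)) 2

lemma theta_three {X : Fin 4 → M → R4} {q : M} (h : IsSymplecticBasis fun i => X i q) (v : ℂ)
    (j : Fin 4) : theta X q v 3 j = Om (X 1 q) (dR4 (X j) q v) := by
  exact congrFun (h.inv_mulVec (dR4 (X j) q v)) 3

lemma IsFirstOrderFrame.isSymplecticBasis {f : M → R4} {U : Set M} {X : Fin 4 → M → R4}
    (h : IsFirstOrderFrame f U X) {q : M} (hq : q ∈ U) : IsSymplecticBasis fun i => X i q :=
  h.symplectic q hq

variable {z : OpenPartialHomeomorph M ℂ}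

lemma mdifferentiable_coord (hz : z ∈ IsManifold.maximalAtlas 𝓘(ℝ, ℂ) ∞ M) :
    z.MDifferentiable 𝓘(ℝ, ℂ) 𝓘(ℝ, ℂ) :=
  ⟨fun _ hx => ((contMDiffAt_of_mem_maximalAtlas hz hx).mdifferentiableAt
      (by simp)).mdifferentiableWithinAt,
    fun _ hx => ((contMDiffAt_symm_of_mem_maximalAtlas hz hx).mdifferentiableAt
      (by simp)).mdifferentiableWithinAt⟩

lemma contDiffOn_comp_symm (hz : z ∈ IsManifold.maximalAtlas 𝓘(ℝ, ℂ) ∞ M) {U : Set M}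
    {g : M → R4} (hg : ContMDiffOn 𝓘(ℝ, ℂ) 𝓘(ℝ, R4) ∞ g U) :
    ContDiffOn ℝ ∞ (g ∘ z.symm) (z.target ∩ z.symm ⁻¹' U) :=
  (hg.comp ((contMDiffOn_symm_of_mem_maximalAtlas hz).mono Set.inter_subset_left)
    fun _ hx => hx.2).contDiffOn

lemma contMDiffOn_comp_coord (hz : z ∈ IsManifold.maximalAtlas 𝓘(ℝ, ℂ) ∞ M)
    {Y : ℂ → R4} (hY : ContDiffOn ℝ ∞ Y z.target) :
    ContMDiffOn 𝓘(ℝ, ℂ) 𝓘(ℝ, R4) ∞ (Y ∘ z) z.source :=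
  hY.contMDiffOn.comp (contMDiffOn_of_mem_maximalAtlas hz) fun _ hx => z.map_source hx

lemma coordDeriv_eq_fderiv {q : M} (hq : MDifferentiableAt 𝓘(ℝ, ℂ) 𝓘(ℝ, ℂ) z q) :
    coordDeriv z q = fderiv ℝ ((chartAt ℂ q).symm.trans z) (chartAt ℂ q q) := by
  rw [coordDeriv, hq.mfderiv]
  simp only [mfld_simps, fderivWithin_univ]
  rfl

lemma coordDeriv_bijective (hz : z ∈ IsManifold.maximalAtlas 𝓘(ℝ, ℂ) ∞ M) {q : M}
    (hq : q ∈ z.source) : Function.Bijective (coordDeriv z q) :=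
  (mdifferentiable_coord hz).mfderiv_bijective hq

lemma area_coordDeriv_ne_zero (hz : z ∈ IsManifold.maximalAtlas 𝓘(ℝ, ℂ) ∞ M) {q : M}
    (hq : q ∈ z.source) : area (coordDeriv z q 1) (coordDeriv z q Complex.I) ≠ 0 := by
  obtain ⟨a, ha⟩ := (coordDeriv_bijective hz hq).2 1
  obtain ⟨b, hb⟩ := (coordDeriv_bijective hz hq).2 Complex.I
  have h := area_map (coordDeriv z q) a b
  rw [ha, hb] at h
  intro h0
  rw [h0] at h
  simp [area] at h

lemma dR4_eq (hz : z ∈ IsManifold.maximalAtlas 𝓘(ℝ, ℂ) ∞ M) {q : M} (hq : q ∈ z.source)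
    {g : M → R4} (hg : DifferentiableAt ℝ (g ∘ z.symm) (z q)) (v : ℂ) :
    dR4 g q v = fderiv ℝ (g ∘ z.symm) (z q) (coordDeriv z q v) := by
  have e : g =ᶠ[𝓝 q] (g ∘ z.symm) ∘ z := by
    filter_upwards [z.open_source.mem_nhds hq] with q' hq'
    simp [z.left_inv hq']
  have h : mfderiv 𝓘(ℝ, ℂ) 𝓘(ℝ, R4) g q
      = (mfderiv 𝓘(ℝ, ℂ) 𝓘(ℝ, R4) (g ∘ z.symm) (z q)).comp (mfderiv 𝓘(ℝ, ℂ) 𝓘(ℝ, ℂ) z q) := by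
    rw [e.mfderiv_eq]
    exact mfderiv_comp q hg.mdifferentiableAt ((mdifferentiable_coord hz).mdifferentiableAt hq)
  rw [mfderiv_eq_fderiv] at h
  exact congrArg (fun L : ℂ →L[ℝ] R4 => L v) h

lemma area_coordDeriv_pos [IsManifold 𝓘(ℝ, ℂ) ∞ M] (ho : IsOrientedAtlas M)
    (hz : z ∈ atlas ℂ M) {q : M} (hq : q ∈ z.source) :
    0 < area (coordDeriv z q 1) (coordDeriv z q Complex.I) := by
  have hz' : z ∈ IsManifold.maximalAtlas 𝓘(ℝ, ℂ) ∞ M := IsManifold.subset_maximalAtlas hz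
  rw [coordDeriv_eq_fderiv ((mdifferentiable_coord hz').mdifferentiableAt hq)]
  refine ho _ (chart_mem_atlas ℂ q) _ hz _ ?_
  simp [hq]

/-- A first order frame field on the surface, read in a coordinate. -/
lemma IsFirstOrderFrame.isPlaneFrame (hz : z ∈ IsManifold.maximalAtlas 𝓘(ℝ, ℂ) ∞ M) {f : M → R4}
    (hf : IsLagrangianImmersion f) {U : Set M} {X : Fin 4 → M → R4}
    (hX : IsFirstOrderFrame f U X) :
    IsPlaneFrame (f ∘ z.symm) (z.target ∩ z.symm ⁻¹' U) fun j => X j ∘ z.symm := by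
  have hfz : ∀ p ∈ z.target, DifferentiableAt ℝ (f ∘ z.symm) (z (z.symm p)) := by
    intro p hp
    rw [z.right_inv hp]
    have := contDiffOn_comp_symm hz hf.smooth.contMDiffOn (U := Set.univ)
    simp only [Set.preimage_univ, Set.inter_univ] at this
    exact (this.contDiffAt (z.open_target.mem_nhds hp)).differentiableAt (by simp)
  refine ⟨z.isOpen_inter_preimage_symm hX.isOpen, contDiffOn_comp_symm hz hf.smooth.contMDiffOn,
    ?_, fun j => contDiffOn_comp_symm hz (hX.smooth j), fun p hp => hX.symplectic _ hp.2, ?_⟩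
  · intro p hp a b
    have hq := z.map_target hp.1
    obtain ⟨a', rfl⟩ := (coordDeriv_bijective hz hq).2 a
    obtain ⟨b', rfl⟩ := (coordDeriv_bijective hz hq).2 b
    have := hf.lagrangian (z.symm p) a' b'
    rwa [dR4_eq hz hq (hfz p hp.1), dR4_eq hz hq (hfz p hp.1), z.right_inv hp.1] at this
  · intro p hp
    have hq := z.map_target hp.1
    obtain ⟨u₁, u₂, hu, h1, h2⟩ := hX.gauss _ hp.2
    rw [dR4_eq hz hq (hfz p hp.1), z.right_inv hp.1] at h1 h2
    refine ⟨_, _, ?_, h1, h2⟩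
    rw [area_map]
    exact mul_ne_zero (area_coordDeriv_ne_zero hz hq) hu.ne

lemma dR4_frame (hz : z ∈ IsManifold.maximalAtlas 𝓘(ℝ, ℂ) ∞ M) {f : M → R4} {U : Set M}
    {X : Fin 4 → M → R4} (hX : IsFirstOrderFrame f U X) {q : M} (hq : q ∈ z.source) (hU : q ∈ U)
    (v : ℂ) (j : Fin 4) :
    dR4 (X j) q v = fderiv ℝ (X j ∘ z.symm) (z q) (coordDeriv z q v) := by
  refine dR4_eq hz hq ?_ v
  have hp : z q ∈ z.target ∩ z.symm ⁻¹' U := ⟨z.map_source hq, by simpa [z.left_inv hq]⟩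
  exact ((contDiffOn_comp_symm hz (hX.smooth j)).contDiffAt
    ((z.isOpen_inter_preimage_symm hX.isOpen).mem_nhds hp)).differentiableAt (by simp)

lemma Om_frame (hz : z ∈ IsManifold.maximalAtlas 𝓘(ℝ, ℂ) ∞ M) {f : M → R4} {U : Set M}
    {X : Fin 4 → M → R4} (hX : IsFirstOrderFrame f U X) {q : M} (hq : q ∈ z.source) (hU : q ∈ U)
    (v : ℂ) (i j : Fin 4) :
    Om (X i q) (dR4 (X j) q v) = conn (fun j => X j ∘ z.symm) (z q) (coordDeriv z q v) i j := by
  rw [dR4_frame hz hX hq hU, conn, Function.comp_apply, z.left_inv hq]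

lemma gaussForm_eq_conn (hz : z ∈ IsManifold.maximalAtlas 𝓘(ℝ, ℂ) ∞ M) {f : M → R4} {U : Set M}
    {X : Fin 4 → M → R4} (hX : IsFirstOrderFrame f U X) {q : M} (hq : q ∈ z.source) (hU : q ∈ U)
    (v : ℂ) : gaussForm X q v =
      -(conn (fun j => X j ∘ z.symm) (z q) (coordDeriv z q v) 0 0 *
        conn (fun j => X j ∘ z.symm) (z q) (coordDeriv z q v) 1 1) +
        conn (fun j => X j ∘ z.symm) (z q) (coordDeriv z q v) 1 0 ^ 2 := by
  have hs := hX.isSymplecticBasis hU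
  rw [gaussForm, theta_two hs, theta_three hs, theta_three hs]
  simp only [Om_frame hz hX hq hU]

/-- The pull back of the conformal structure by the Gauss map does not depend, up to a positive
factor, on the first order frame: it is the Hessian of the cubic form. -/
lemma exists_gaussForm_eq (hz : z ∈ IsManifold.maximalAtlas 𝓘(ℝ, ℂ) ∞ M) {f : M → R4}
    (hf : IsLagrangianImmersion f) {U : Set M}
    {X : Fin 4 → M → R4} (hX : IsFirstOrderFrame f U X) {q : M} (hq : q ∈ z.source) (hU : q ∈ U) :
    ∃ r : ℝ, 0 < r ∧ ∀ v, gaussForm X q v = r * hess (f ∘ z.symm) (z q) (coordDeriv z q v) := by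
  have hp : z q ∈ z.target ∩ z.symm ⁻¹' U := ⟨z.map_source hq, by simpa [z.left_inv hq]⟩
  have hP := hX.isPlaneFrame hz hf
  obtain ⟨w₀, w₁, hw, h0, h1⟩ := hP.tangent _ hp
  refine ⟨area w₀ w₁ ^ 2, by positivity, fun v => ?_⟩
  rw [gaussForm_eq_conn hz hX hq hU, hP.gauss_eq_hess hp h0 h1]

lemma IsElliptic.hess_pos {f : M → R4} (hf : IsElliptic f)
    (hz : z ∈ IsManifold.maximalAtlas 𝓘(ℝ, ℂ) ∞ M) {q : M} (hq : q ∈ z.source) {v : ℂ}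
    (hv : v ≠ 0) : 0 < hess (f ∘ z.symm) (z q) v := by
  obtain ⟨U, X, hU, hX, hpos⟩ := hf.spacelike q
  obtain ⟨r, hr, h⟩ := exists_gaussForm_eq hz hf.toIsLagrangianImmersion hX hq hU
  obtain ⟨v', rfl⟩ := (coordDeriv_bijective hz hq).2 v
  have hv' : v' ≠ 0 := by rintro rfl; exact hv (map_zero _)
  have := hpos v' hv'
  rw [h] at this
  exact (mul_pos_iff_of_pos_left hr).1 this

end Surface

/-! ### Third order frames on the surface -/

lemma conn_congr {Y Y' : Fin 4 → ℂ → R4} {p : ℂ} (h : ∀ j, Y j =ᶠ[𝓝 p] Y' j) (v : ℂ)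
    (i j : Fin 4) : conn Y p v i j = conn Y' p v i j := by
  rw [conn, conn, (h i).self_of_nhds, (h j).fderiv_eq]

section Surface

variable {M : Type*} [TopologicalSpace M] [ChartedSpace ℂ M]
  {z : OpenPartialHomeomorph M ℂ} {f : M → R4} {U : Set M} {X : Fin 4 → M → R4}

lemma omegaC_eq_conn (hz : z ∈ IsManifold.maximalAtlas 𝓘(ℝ, ℂ) ∞ M) (hX : IsFirstOrderFrame f U X)
    {q : M} (hq : q ∈ z.source) (hU : q ∈ U) (v : ℂ) : omegaC X q v =
      ⟨(conn (fun j => X j ∘ z.symm) (z q) (coordDeriv z q v) 0 0 -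
        conn (fun j => X j ∘ z.symm) (z q) (coordDeriv z q v) 1 1) / 2,
        conn (fun j => X j ∘ z.symm) (z q) (coordDeriv z q v) 1 0⟩ := by
  have hs := hX.isSymplecticBasis hU
  rw [omegaC, theta_two hs, theta_three hs, theta_three hs]
  simp only [Om_frame hz hX hq hU]

lemma etaC_eq_conn (hz : z ∈ IsManifold.maximalAtlas 𝓘(ℝ, ℂ) ∞ M) (hX : IsFirstOrderFrame f U X)
    {q : M} (hq : q ∈ z.source) (hU : q ∈ U) (v : ℂ) : etaC X q v =
      ⟨(conn (fun j => X j ∘ z.symm) (z q) (coordDeriv z q v) 3 1 -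
        conn (fun j => X j ∘ z.symm) (z q) (coordDeriv z q v) 2 0) / 2,
        (conn (fun j => X j ∘ z.symm) (z q) (coordDeriv z q v) 3 0 +
        conn (fun j => X j ∘ z.symm) (z q) (coordDeriv z q v) 2 1) / 2⟩ := by
  have hs := hX.isSymplecticBasis hU
  rw [etaC, theta_zero hs, theta_zero hs, theta_one hs, theta_one hs]
  simp only [Om_frame hz hX hq hU]
  congr 1 <;> ring

lemma trace_theta_eq_conn (hz : z ∈ IsManifold.maximalAtlas 𝓘(ℝ, ℂ) ∞ M)
    (hX : IsFirstOrderFrame f U X) {q : M} (hq : q ∈ z.source) (hU : q ∈ U) (v : ℂ) :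
    theta X q v 2 0 + theta X q v 3 1 =
      conn (fun j => X j ∘ z.symm) (z q) (coordDeriv z q v) 0 0 +
        conn (fun j => X j ∘ z.symm) (z q) (coordDeriv z q v) 1 1 := by
  have hs := hX.isSymplecticBasis hU
  rw [theta_two hs, theta_three hs]
  simp only [Om_frame hz hX hq hU]

lemma IsSecondOrderFrame.conn_trace (hz : z ∈ IsManifold.maximalAtlas 𝓘(ℝ, ℂ) ∞ M)
    (hX : IsSecondOrderFrame f U X) {p : ℂ} (hp : p ∈ z.target ∩ z.symm ⁻¹' U) (v : ℂ) :
    conn (fun j => X j ∘ z.symm) p v 0 0 + conn (fun j => X j ∘ z.symm) p v 1 1 = 0 := by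
  have hq := z.map_target hp.1
  obtain ⟨v, rfl⟩ := (coordDeriv_bijective hz hq).2 v
  have h := hX.trace_gamma _ hp.2 v
  rw [trace_theta_eq_conn hz hX.toIsFirstOrderFrame hq hp.2, z.right_inv hp.1] at h
  linarith

lemma IsThirdOrderFrame.exists_eta_eq (hz : z ∈ IsManifold.maximalAtlas 𝓘(ℝ, ℂ) ∞ M)
    (hX : IsThirdOrderFrame f U X) {p : ℂ} (hp : p ∈ z.target ∩ z.symm ⁻¹' U) :
    ∃ h : ℂ, ∀ v,
      (⟨(conn (fun j => X j ∘ z.symm) p v 3 1 - conn (fun j => X j ∘ z.symm) p v 2 0) / 2,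
      (conn (fun j => X j ∘ z.symm) p v 3 0 + conn (fun j => X j ∘ z.symm) p v 2 1) / 2⟩ : ℂ) =
      h * ⟨conn (fun j => X j ∘ z.symm) p v 0 0, conn (fun j => X j ∘ z.symm) p v 1 0⟩ := by
  have hq := z.map_target hp.1
  obtain ⟨h, hh⟩ := hX.eta_type
  refine ⟨h (z.symm p), fun v => ?_⟩
  have ht := hX.conn_trace hz hp v
  obtain ⟨v, rfl⟩ := (coordDeriv_bijective hz hq).2 v
  have h1 := hh _ hp.2 v
  rw [etaC_eq_conn hz hX.toIsFirstOrderFrame hq hp.2,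
    omegaC_eq_conn hz hX.toIsFirstOrderFrame hq hp.2, z.right_inv hp.1,
    eq_neg_of_add_eq_zero_right ht] at h1
  rw [h1]
  congr 2
  ring

/-- In a chart of the oriented atlas, the Gauss plane is negatively oriented. -/
lemma IsFirstOrderFrame.exists_area_neg [IsManifold 𝓘(ℝ, ℂ) ∞ M] (ho : IsOrientedAtlas M)
    (hz : z ∈ atlas ℂ M)
    (hf : IsLagrangianImmersion f) (hX : IsFirstOrderFrame f U X) {p : ℂ}
    (hp : p ∈ z.target ∩ z.symm ⁻¹' U) :
    ∃ w₀ w₁, area w₀ w₁ < 0 ∧ fderiv ℝ (f ∘ z.symm) p w₀ = X 0 (z.symm p) ∧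
      fderiv ℝ (f ∘ z.symm) p w₁ = X 1 (z.symm p) := by
  have hz' : z ∈ IsManifold.maximalAtlas 𝓘(ℝ, ℂ) ∞ M := IsManifold.subset_maximalAtlas hz
  have hq := z.map_target hp.1
  obtain ⟨u₁, u₂, hu, h1, h2⟩ := hX.gauss _ hp.2
  have hP := hX.isPlaneFrame hz' hf
  have hd : DifferentiableAt ℝ (f ∘ z.symm) (z (z.symm p)) := by
    rw [z.right_inv hp.1]
    exact (hP.contDiffAt_map hp).differentiableAt (by norm_num)
  rw [dR4_eq hz' hq hd, z.right_inv hp.1] at h1 h2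
  refine ⟨_, _, ?_, h1, h2⟩
  rw [area_map]
  exact mul_neg_of_pos_of_neg (area_coordDeriv_pos ho hz hq) hu

/-- Third order frames exist along Lagrangian immersions whose Gauss map is spacelike. -/
lemma exists_isThirdOrderFrame [IsManifold 𝓘(ℝ, ℂ) ∞ M] (ho : IsOrientedAtlas M)
    (hf : IsLagrangianImmersion f)
    (hz : z ∈ atlas ℂ M) (hpos : ∀ p ∈ z.target, ∀ v, v ≠ 0 → 0 < hess (f ∘ z.symm) p v) :
    ∃ X, IsThirdOrderFrame f z.source X := by
  have hz' : z ∈ IsManifold.maximalAtlas 𝓘(ℝ, ℂ) ∞ M := IsManifold.subset_maximalAtlas hz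
  have hφ : ContDiffOn ℝ ∞ (f ∘ z.symm) z.target := by
    have := contDiffOn_comp_symm hz' hf.smooth.contMDiffOn (U := Set.univ)
    simpa using this
  have hd : ∀ q ∈ z.source, DifferentiableAt ℝ (f ∘ z.symm) (z q) := fun q hq =>
    (hφ.contDiffAt (z.open_target.mem_nhds (z.map_source hq))).differentiableAt (by simp)
  have hdf : ∀ q ∈ z.source, ∀ v, dR4 f q v = fderiv ℝ (f ∘ z.symm) (z q) (coordDeriv z q v) :=
    fun q hq v => dR4_eq hz' hq (hd q hq) v
  obtain ⟨Y, hY, h2, hw, h3⟩ := exists_third_order_plane_frame z.open_target hφ (by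
      intro p hp a b
      have hq := z.map_target hp
      obtain ⟨a, rfl⟩ := (coordDeriv_bijective hz' hq).2 a
      obtain ⟨b, rfl⟩ := (coordDeriv_bijective hz' hq).2 b
      have := hf.lagrangian (z.symm p) a b
      rwa [hdf _ hq, hdf _ hq, z.right_inv hp] at this) (by
      intro p hp a b hab
      have hq := z.map_target hp
      obtain ⟨a, rfl⟩ := (coordDeriv_bijective hz' hq).2 a
      obtain ⟨b, rfl⟩ := (coordDeriv_bijective hz' hq).2 b
      have h1 := hdf _ hq a
      have h2 := hdf _ hq b
      rw [z.right_inv hp] at h1 h2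
      rw [← h1, ← h2] at hab
      rw [hf.immersion _ hab]) hpos
  have hX : IsFirstOrderFrame f z.source fun j => Y j ∘ z := by
    refine ⟨z.open_source, fun j => contMDiffOn_comp_coord hz' (hY.smooth j),
      fun q hq => hY.symplectic _ (z.map_source hq), fun q hq => ?_⟩
    obtain ⟨w₀, w₁, ha, e0, e1⟩ := hw _ (z.map_source hq)
    obtain ⟨u₀, rfl⟩ := (coordDeriv_bijective hz' hq).2 w₀
    obtain ⟨u₁, rfl⟩ := (coordDeriv_bijective hz' hq).2 w₁
    refine ⟨u₀, u₁, ?_, (hdf _ hq _).trans e0, (hdf _ hq _).trans e1⟩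
    rw [area_map] at ha
    exact (pos_iff_neg_of_mul_neg ha).1 (area_coordDeriv_pos ho hz hq)
  have hc : ∀ q ∈ z.source, ∀ v i j,
      conn (fun j => (Y j ∘ z) ∘ z.symm) (z q) v i j = conn Y (z q) v i j := by
    intro q hq v i j
    refine conn_congr (fun j => ?_) v i j
    filter_upwards [z.open_target.mem_nhds (z.map_source hq)] with p hp
    simp [z.right_inv hp]
  have h2' : ∀ q ∈ z.source, ∀ v, conn Y (z q) v 0 0 + conn Y (z q) v 1 1 = 0 := fun q hq =>
    h2 _ (z.map_source hq)
  choose! h hh using h3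
  refine ⟨fun j => Y j ∘ z, ⟨⟨hX, fun q hq v => ?_⟩, fun q => h (z q), fun q hq v => ?_⟩⟩
  · rw [trace_theta_eq_conn hz' hX hq hq, hc q hq, hc q hq, h2' q hq, zero_div]
  · rw [etaC_eq_conn hz' hX hq hq, omegaC_eq_conn hz' hX hq hq]
    simp only [hc q hq]
    rw [hh _ (z.map_source hq), eq_neg_of_add_eq_zero_right (h2' q hq _)]
    congr 2
    ring

/-- If near a point a third order frame satisfies `N X₀ = -X₁` for a constant complex structure `N`,
then the frame is unitary for `N` there, and its form `η` vanishes. -/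
lemma IsThirdOrderFrame.unitary_of_adapted (hz : z ∈ IsManifold.maximalAtlas 𝓘(ℝ, ℂ) ∞ M)
    (hf : IsLagrangianImmersion f) (hX : IsThirdOrderFrame f U X) {q : M} (hq : q ∈ z.source)
    (hU : q ∈ U) (hpos : ∀ v, v ≠ 0 → 0 < hess (f ∘ z.symm) (z q) v)
    {N : R4 →ₗ[ℝ] R4} (hN : IsOmComplex N)
    (hNX : ∀ᶠ p in 𝓝 (z q), N (X 0 (z.symm p)) = -X 1 (z.symm p)) :
    N = cplx (fun i => X i q) ∧ ∀ v, etaC X q v = 0 := by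
  have hp : z q ∈ z.target ∩ z.symm ⁻¹' U := ⟨z.map_source hq, by simpa [z.left_inv hq]⟩
  have hP := hX.isPlaneFrame hz hf
  obtain ⟨h1, h2⟩ := SymplecticSurface.unitary_of_adapted hN (hP.symplectic _ hp)
    (hP.differentiableAt hp) hNX
    (hP.omega_det_ne_zero hp (hX.conn_trace hz hp) hpos) (hX.exists_eta_eq hz hp)
  refine ⟨by simpa [z.left_inv hq] using h1, fun v => ?_⟩
  rw [etaC_eq_conn hz hX.toIsFirstOrderFrame hq hU]
  obtain ⟨a, b⟩ := h2 (coordDeriv z q v)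
  apply Complex.ext
  · simp only [Complex.zero_re]
    linarith
  · simp only [Complex.zero_im]
    linarith

end Surface

/-! ### Holomorphic curves -/

/-- The complex area form of `ℂ²`. -/
def det2 (x y : ℂ × ℂ) : ℂ := x.1 * y.2 - x.2 * y.1

/-- The identification of `ℝ⁴` with `ℂ²` as a real linear equivalence. -/
def toC2Equiv : R4 ≃L[ℝ] ℂ × ℂ :=
  LinearEquiv.toContinuousLinearEquiv
    { toFun := toC2
      map_add' := fun x y => by
        simp only [toC2, Pi.add_apply, Prod.mk_add_mk]
        refine Prod.ext (Complex.ext ?_ ?_) (Complex.ext ?_ ?_) <;> simp [add_comm]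
      map_smul' := fun c x => by
        simp only [toC2, Pi.smul_apply, smul_eq_mul, RingHom.id_apply, Prod.smul_mk]
        refine Prod.ext (Complex.ext ?_ ?_) (Complex.ext ?_ ?_) <;> simp
      invFun := fun w => ![w.1.re, -w.1.im, w.2.re, w.2.im]
      left_inv := fun x => by
        ext i
        fin_cases i <;> simp [toC2]
      right_inv := fun w => by
        simp [toC2] }

lemma toC2Equiv_apply (x : R4) : toC2Equiv x = toC2 x := rfl

lemma Om_eq_det2 (x y : R4) : Om x y = (det2 (toC2Equiv x) (toC2Equiv y)).re := by
  simp [Om_eq, det2, toC2Equiv_apply, toC2]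
  ring

section Holomorphic

variable {φ : ℂ → R4} {V : Set ℂ} {A : R4 →L[ℝ] ℂ × ℂ} {p : ℂ}

lemma map_fderiv_of_holomorphic (hV : IsOpen V) (hφ : ContDiffOn ℝ ∞ φ V)
    (hψ : DifferentiableOn ℂ (fun p => A (φ p)) V) (hp : p ∈ V) (a : ℂ) :
    A (fderiv ℝ φ p a) = a • deriv (fun p => A (φ p)) p := by
  have h1 : HasFDerivAt (fun p => A (φ p)) (A.comp (fderiv ℝ φ p)) p :=
    A.hasFDerivAt.comp p
      ((hφ.contDiffAt (hV.mem_nhds hp)).differentiableAt (by simp)).hasFDerivAt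
  have h2 := ((hψ.differentiableAt (hV.mem_nhds hp)).hasDerivAt.hasFDerivAt).restrictScalars ℝ
  have := congrArg (fun L : ℂ →L[ℝ] ℂ × ℂ => L a) (h1.unique h2)
  simpa using this

lemma map_fderiv_fderiv_of_holomorphic (hV : IsOpen V) (hφ : ContDiffOn ℝ ∞ φ V)
    (hψ : DifferentiableOn ℂ (fun p => A (φ p)) V) (hp : p ∈ V) (v b : ℂ) :
    A (fderiv ℝ (fderiv ℝ φ) p v b) = (v * b) • deriv (deriv (fun p => A (φ p))) p := by
  have hφ2 : ContDiffAt ℝ 2 φ p := (hφ.contDiffAt (hV.mem_nhds hp)).of_le two_le_infty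
  have h1 : HasFDerivAt (fun p => A (fderiv ℝ φ p b))
      (A.comp (fderiv ℝ (fun p => fderiv ℝ φ p b) p)) p :=
    A.hasFDerivAt.comp p (differentiableAt_fderiv_apply hφ2 b).hasFDerivAt
  have hd : DifferentiableAt ℂ (deriv fun p => A (φ p)) p :=
    (hψ.deriv hV).differentiableAt (hV.mem_nhds hp)
  have h2 := ((hd.hasDerivAt.const_smul b).hasFDerivAt).restrictScalars ℝ
  have e : (fun p => A (fderiv ℝ φ p b)) =ᶠ[𝓝 p] b • deriv fun p => A (φ p) := by
    filter_upwards [hV.mem_nhds hp] with p' hp'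
    rw [map_fderiv_of_holomorphic hV hφ hψ hp', Pi.smul_apply]
  have := congrArg (fun L : ℂ →L[ℝ] ℂ × ℂ => L v) (h1.unique (h2.congr_of_eventuallyEq e))
  simp only [ContinuousLinearMap.comp_apply, fderiv_fderiv_apply hφ2] at this
  rw [this]
  simp [mul_smul]

/-- The cubic form of a complex curve is the real part of `F_z ∧ F_zz dz³`. -/
lemma cubic_of_holomorphic (hV : IsOpen V) (hφ : ContDiffOn ℝ ∞ φ V)
    (hA : ∀ x y, Om x y = (det2 (A x) (A y)).re)
    (hψ : DifferentiableOn ℂ (fun p => A (φ p)) V) (hp : p ∈ V) (a b v : ℂ) :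
    cubic φ p a b v = (a * b * v * det2 (deriv (fun p => A (φ p)) p)
      (deriv (deriv (fun p => A (φ p))) p)).re := by
  rw [cubic, hA, map_fderiv_of_holomorphic hV hφ hψ hp,
    map_fderiv_fderiv_of_holomorphic hV hφ hψ hp]
  congr 1
  simp only [det2, Prod.smul_fst, Prod.smul_snd, smul_eq_mul]
  ring

lemma hess_of_holomorphic (hV : IsOpen V) (hφ : ContDiffOn ℝ ∞ φ V)
    (hA : ∀ x y, Om x y = (det2 (A x) (A y)).re)
    (hψ : DifferentiableOn ℂ (fun p => A (φ p)) V) (hp : p ∈ V) (v : ℂ) :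
    hess φ p v = Complex.normSq (det2 (deriv (fun p => A (φ p)) p)
      (deriv (deriv (fun p => A (φ p))) p)) * Complex.normSq v := by
  simp only [hess, cubic_of_holomorphic hV hφ hA hψ hp]
  simp [Complex.normSq_apply]
  ring

/-- Conformal negative frames of the tangent plane of a complex curve are adapted to the complex
structure `N` of the ambient space. -/
lemma adapted_of_holomorphic {N : R4 →ₗ[ℝ] R4} (hAN : ∀ x, A (N x) = Complex.I • A x)
    (hinj : Function.Injective A) (hV : IsOpen V) (hφ : ContDiffOn ℝ ∞ φ V)
    (hA : ∀ x y, Om x y = (det2 (A x) (A y)).re)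
    (hψ : DifferentiableOn ℂ (fun p => A (φ p)) V) (hp : p ∈ V)
    (hL : ∀ᶠ p' in 𝓝 p, ∀ a b, Om (fderiv ℝ φ p' a) (fderiv ℝ φ p' b) = 0)
    (hpos : ∀ v, v ≠ 0 → 0 < hess φ p v) {w₀ w₁ : ℂ} (hw : area w₀ w₁ < 0)
    (hcw : ∀ v, cubic φ p w₀ w₀ v + cubic φ p w₁ w₁ v = 0) :
    N (fderiv ℝ φ p w₀) = -fderiv ℝ φ p w₁ := by
  have hφ2 : ContDiffAt ℝ 2 φ p := (hφ.contDiffAt (hV.mem_nhds hp)).of_le two_le_infty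
  refine adapted_of_adapted (y₀ := 1) (y₁ := -Complex.I) hφ2 hL hpos (by simp [area]) hw ?_ hcw
    ?_ ?_
  · intro v
    rw [cubic_of_holomorphic hV hφ hA hψ hp, cubic_of_holomorphic hV hφ hA hψ hp,
      ← Complex.add_re]
    simp
  · apply hinj
    rw [hAN, map_neg, map_fderiv_of_holomorphic hV hφ hψ hp,
      map_fderiv_of_holomorphic hV hφ hψ hp]
    module
  · apply hinj
    rw [hAN, map_fderiv_of_holomorphic hV hφ hψ hp,
      map_fderiv_of_holomorphic hV hφ hψ hp, smul_smul]
    simp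

end Holomorphic

/-! ### Complex curves are totally umbilic -/

section ComplexCurve

variable {M : Type*} [TopologicalSpace M] [ChartedSpace ℂ M]

lemma IsRiemannSurface.isManifold_real (h : IsRiemannSurface (M := M) inferInstance) :
    IsManifold 𝓘(ℝ, ℂ) ∞ M := by
  have h' : IsManifold 𝓘(ℂ) ω M := h
  apply isManifold_of_contDiffOn
  intro e e' he he'
  have hc := (contDiffGroupoid ω 𝓘(ℂ)).compatible he he'
  have h1 := (contMDiffOn_of_mem_contDiffGroupoid hc).contDiffOn
  have h2 : ContDiffOn ℝ ∞ (e.symm ≫ₕ e') (e.symm ≫ₕ e').source :=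
    (h1.restrict_scalars ℝ).of_le le_top
  simpa using h2

lemma isOrientedAtlas_of_isRiemannSurface (h : IsRiemannSurface (M := M) inferInstance) :
    IsOrientedAtlas M := by
  have h' : IsManifold 𝓘(ℂ) ω M := h
  intro e he e' he' x hx
  have hc := (contDiffGroupoid ω 𝓘(ℂ)).compatible he he'
  have h1 := (contMDiffOn_of_mem_contDiffGroupoid hc).contDiffOn
  have hc' := (contDiffGroupoid ω 𝓘(ℂ)).compatible he' he
  have h2 := (contMDiffOn_of_mem_contDiffGroupoid hc').contDiffOn
  have hd1 : DifferentiableAt ℂ (e.symm ≫ₕ e') x :=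
    (h1.contDiffAt ((e.symm ≫ₕ e').open_source.mem_nhds hx)).differentiableAt (by simp)
  have hy : (e.symm ≫ₕ e') x ∈ (e'.symm ≫ₕ e).source := by
    have := (e.symm ≫ₕ e').map_source hx
    rwa [← OpenPartialHomeomorph.symm_source, OpenPartialHomeomorph.trans_symm_eq_symm_trans_symm,
      OpenPartialHomeomorph.symm_symm] at this
  have hd2 : DifferentiableAt ℂ (e'.symm ≫ₕ e) ((e.symm ≫ₕ e') x) :=
    (h2.contDiffAt ((e'.symm ≫ₕ e).open_source.mem_nhds hy)).differentiableAt (by simp)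
  have hne : deriv (e.symm ≫ₕ e') x ≠ 0 := by
    intro h0
    have h3 := hd2.hasDerivAt.comp x hd1.hasDerivAt
    rw [h0, mul_zero] at h3
    have e1 : (e'.symm ≫ₕ e) ∘ (e.symm ≫ₕ e') =ᶠ[𝓝 x] id := by
      filter_upwards [(e.symm ≫ₕ e').open_source.mem_nhds hx] with y hy
      simp only [OpenPartialHomeomorph.trans_source, OpenPartialHomeomorph.symm_source,
        Set.mem_inter_iff, Set.mem_preimage] at hy
      simp [e'.left_inv hy.2, e.right_inv hy.1]
    have h4 := (h3.congr_of_eventuallyEq e1.symm).unique (hasDerivAt_id x)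
    exact zero_ne_one h4
  have hf : fderiv ℝ (e.symm ≫ₕ e') x = (fderiv ℂ (e.symm ≫ₕ e') x).restrictScalars ℝ :=
    hd1.fderiv_restrictScalars ℝ
  change 0 < area (fderiv ℝ (e.symm ≫ₕ e') x 1) (fderiv ℝ (e.symm ≫ₕ e') x Complex.I)
  have hn := Complex.normSq_pos.2 hne
  rw [Complex.normSq_apply] at hn
  rw [hf]
  simp only [ContinuousLinearMap.coe_restrictScalars', fderiv_eq_smul_deriv, area]
  simpa using hn

/-- Third order frames along a complex curve have `η = 0`. -/
lemma eta_eq_zero_of_holomorphic [IsManifold 𝓘(ℝ, ℂ) ∞ M] (ho : IsOrientedAtlas M) {f : M → R4}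
    (hf : IsLagrangianImmersion f) {z : OpenPartialHomeomorph M ℂ} (hz : z ∈ atlas ℂ M)
    (hφ : ContDiffOn ℝ ∞ (f ∘ z.symm) z.target)
    (hψ : DifferentiableOn ℂ (fun p => (toC2Equiv : R4 →L[ℝ] ℂ × ℂ) ((f ∘ z.symm) p)) z.target)
    (hpos : ∀ p ∈ z.target, ∀ v, v ≠ 0 → 0 < hess (f ∘ z.symm) p v) {U : Set M}
    {X : Fin 4 → M → R4} (hX : IsThirdOrderFrame f U X) {q : M} (hq : q ∈ z.source) (hU : q ∈ U)
    (v : ℂ) : etaC X q v = 0 := by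
  have hz' : z ∈ IsManifold.maximalAtlas 𝓘(ℝ, ℂ) ∞ M := IsManifold.subset_maximalAtlas hz
  have hstd : IsSymplecticBasis fun i => (Pi.single i 1 : R4) := by
    apply isSymplecticBasis_of <;> simp [Om_eq]
  have hAN : ∀ x, (toC2Equiv : R4 →L[ℝ] ℂ × ℂ) (cplx (fun i => (Pi.single i 1 : R4)) x)
      = Complex.I • (toC2Equiv : R4 →L[ℝ] ℂ × ℂ) x := by
    intro x
    change toC2 (cplx (fun i => (Pi.single i 1 : R4)) x) = Complex.I • toC2 x
    simp only [cplx_apply, Om_eq, toC2, Prod.smul_mk]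
    congr 1 <;> (apply Complex.ext <;> simp)
  have hP := hX.isPlaneFrame hz' hf
  have hmem : z q ∈ z.target ∩ z.symm ⁻¹' U := ⟨z.map_source hq, by simpa [z.left_inv hq]⟩
  refine (hX.unitary_of_adapted hz' hf hq hU (hpos _ (z.map_source hq))
    hstd.isOmComplex_cplx ?_).2 v
  filter_upwards [hP.isOpen.mem_nhds hmem] with p hp
  obtain ⟨w₀, w₁, hw, h0, h1⟩ := hX.exists_area_neg ho hz hf hp
  rw [← h0, ← h1]
  refine adapted_of_holomorphic hAN toC2Equiv.injective z.open_target hφ Om_eq_det2 hψ hp.1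
    (hP.eventually_lagrangian hp) (hpos p hp.1) hw fun v => ?_
  obtain ⟨e1, -, e3⟩ := hP.gamma_eq_cubic hp h0 h1 v
  rw [← e1, ← e3]
  exact hX.conn_trace hz' hp v

/-- A complex curve without flex points is an elliptic, totally umbilic Lagrangian immersion: in a
complex coordinate its cubic form is `Re (W dz³)` with `W = F_z ∧ F_zz`, and its second order
frames are adapted to the constant complex structure of `ℂ²`. -/
theorem isTotallyUmbilic_of_complexCurve (hM : IsRiemannSurface (M := M) inferInstance) {f : M → R4}
    (hF : IsFlexFreeComplexCurve (M := M) inferInstance fun q => toC2 (f q)) :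
    IsTotallyUmbilic f ∧ HasThirdOrderFrames f := by
  have hMC : IsManifold 𝓘(ℂ) ω M := hM
  have hMC1 : IsManifold 𝓘(ℂ) 1 M := IsManifold.of_le (n := ω) le_top
  have hMR : IsManifold 𝓘(ℝ, ℂ) ∞ M := hM.isManifold_real
  have ho : IsOrientedAtlas M := isOrientedAtlas_of_isRiemannSurface hM
  set A : R4 →L[ℝ] ℂ × ℂ := (toC2Equiv : R4 →L[ℝ] ℂ × ℂ) with hA
  have hψ : ∀ z ∈ atlas ℂ M, DifferentiableOn ℂ (fun p => A ((f ∘ z.symm) p)) z.target := by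
    intro z hz
    have h1 : MDifferentiableOn 𝓘(ℂ) 𝓘(ℂ, ℂ × ℂ) ((fun q => toC2 (f q)) ∘ z.symm) z.target :=
      hF.holomorphic.comp_mdifferentiableOn (mdifferentiableOn_atlas_symm hz)
    exact h1.differentiableOn
  have hφ : ∀ z ∈ atlas ℂ M, ContDiffOn ℝ ∞ (f ∘ z.symm) z.target := by
    intro z hz
    have h1 : ContDiffOn ℂ ∞ (fun p => A ((f ∘ z.symm) p)) z.target :=
      (hψ z hz).contDiffOn z.open_target
    have h2 := (toC2Equiv.symm : ℂ × ℂ →L[ℝ] R4).contDiff.comp_contDiffOn (h1.restrict_scalars ℝ)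
    refine h2.congr fun p _ => ?_
    simp [A]
  have hW : ∀ z ∈ atlas ℂ M, ∀ p ∈ z.target, det2 (deriv (fun p => A ((f ∘ z.symm) p)) p)
      (deriv (deriv (fun p => A ((f ∘ z.symm) p))) p) ≠ 0 := by
    intro z hz p hp
    have := hF.no_flex z hz _ (z.map_target hp)
    rw [z.right_inv hp] at this
    exact this
  have hmax : ∀ z ∈ atlas ℂ M, z ∈ IsManifold.maximalAtlas 𝓘(ℝ, ℂ) ∞ M := fun z hz =>
    IsManifold.subset_maximalAtlas hz
  have hdf : ∀ q v, dR4 f q v = fderiv ℝ (f ∘ (chartAt ℂ q).symm) (chartAt ℂ q q)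
      (coordDeriv (chartAt ℂ q) q v) := fun q v =>
    dR4_eq (hmax _ (chart_mem_atlas ℂ q)) (mem_chart_source ℂ q)
      (((hφ _ (chart_mem_atlas ℂ q)).contDiffAt ((chartAt ℂ q).open_target.mem_nhds
        (mem_chart_target ℂ q))).differentiableAt (by simp)) v
  have hAd : ∀ q v, A (dR4 f q v) = coordDeriv (chartAt ℂ q) q v •
      deriv (fun p => A ((f ∘ (chartAt ℂ q).symm) p)) (chartAt ℂ q q) := fun q v => by
    rw [hdf, map_fderiv_of_holomorphic (chartAt ℂ q).open_target (hφ _ (chart_mem_atlas ℂ q))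
      (hψ _ (chart_mem_atlas ℂ q)) (mem_chart_target ℂ q)]
  have hLag : IsLagrangianImmersion f := by
    refine ⟨fun q => ?_, fun q a b hab => ?_, fun q u v => ?_⟩
    · have h1 := (contMDiffOn_comp_coord (hmax _ (chart_mem_atlas ℂ q))
        (hφ _ (chart_mem_atlas ℂ q))).contMDiffAt
        ((chartAt ℂ q).open_source.mem_nhds (mem_chart_source ℂ q))
      refine h1.congr_of_eventuallyEq ?_
      filter_upwards [(chartAt ℂ q).open_source.mem_nhds (mem_chart_source ℂ q)] with q' hq'
      simp [(chartAt ℂ q).left_inv hq']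
    · have h1 := congrArg A hab
      rw [hAd, hAd] at h1
      refine (coordDeriv_bijective (hmax _ (chart_mem_atlas ℂ q)) (mem_chart_source ℂ q)).1 ?_
      refine smul_left_injective ℂ (fun h0 => ?_) h1
      apply hW _ (chart_mem_atlas ℂ q) _ (mem_chart_target ℂ q)
      rw [h0]
      simp [det2]
    · have : Om (dR4 f q u) (dR4 f q v) = (det2 (A (dR4 f q u)) (A (dR4 f q v))).re :=
        Om_eq_det2 _ _
      rw [this, hAd, hAd]
      have h0 : ∀ (a b : ℂ) (x : ℂ × ℂ), det2 (a • x) (b • x) = 0 := fun a b x => by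
        simp only [det2, Prod.smul_fst, Prod.smul_snd, smul_eq_mul]
        ring
      rw [h0, Complex.zero_re]
  have hpos : ∀ z ∈ atlas ℂ M, ∀ p ∈ z.target, ∀ v, v ≠ 0 → 0 < hess (f ∘ z.symm) p v := by
    intro z hz p hp v hv
    rw [hess_of_holomorphic z.open_target (hφ z hz) Om_eq_det2 (hψ z hz) hp]
    exact mul_pos (Complex.normSq_pos.2 (hW z hz p hp)) (Complex.normSq_pos.2 hv)
  have hthird : HasThirdOrderFrames f := fun q => by
    obtain ⟨X, hX⟩ := exists_isThirdOrderFrame ho hLag (chart_mem_atlas ℂ q)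
      (hpos _ (chart_mem_atlas ℂ q))
    exact ⟨_, X, mem_chart_source ℂ q, hX⟩
  refine ⟨⟨⟨hLag, fun q => ?_⟩, fun U X hX q hU v => ?_⟩, hthird⟩
  · obtain ⟨U, X, hU, hX⟩ := hthird q
    refine ⟨U, X, hU, hX.toIsFirstOrderFrame, fun v hv => ?_⟩
    obtain ⟨r, hr, h⟩ := exists_gaussForm_eq (hmax _ (chart_mem_atlas ℂ q)) hLag
      hX.toIsFirstOrderFrame (mem_chart_source ℂ q) hU
    rw [h]
    refine mul_pos hr (hpos _ (chart_mem_atlas ℂ q) _ (mem_chart_target ℂ q) _ fun h0 => hv ?_)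
    exact (coordDeriv_bijective (hmax _ (chart_mem_atlas ℂ q)) (mem_chart_source ℂ q)).1
      (h0.trans (map_zero _).symm)
  · rw [hopf, eta_eq_zero_of_holomorphic ho hLag (chart_mem_atlas ℂ q)
      (hφ _ (chart_mem_atlas ℂ q)) (hψ _ (chart_mem_atlas ℂ q)) (hpos _ (chart_mem_atlas ℂ q)) hX
      (mem_chart_source ℂ q) hU, zero_mul, mul_zero]

end ComplexCurve

/-! ### The constant complex structure of a totally umbilic immersion -/

lemma coord_mem {M : Type*} [TopologicalSpace M] {z : OpenPartialHomeomorph M ℂ} {U : Set M} {q : M}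
    (hq : q ∈ z.source) (hU : q ∈ U) : z q ∈ z.target ∩ z.symm ⁻¹' U :=
  ⟨z.map_source hq, by simpa [z.left_inv hq]⟩

section Umbilic

variable {M : Type*} [TopologicalSpace M] [ChartedSpace ℂ M]
  {f : M → R4} {U : Set M} {X : Fin 4 → M → R4}

lemma chart_mem_maximalAtlas_real [IsManifold 𝓘(ℝ, ℂ) ∞ M] (q : M) :
    chartAt ℂ q ∈ IsManifold.maximalAtlas 𝓘(ℝ, ℂ) ∞ M :=
  IsManifold.subset_maximalAtlas (chart_mem_atlas ℂ q)

lemma tauC_ne_zero (hf : IsLagrangianImmersion f) (hX : IsFirstOrderFrame f U X) {q : M}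
    (hU : q ∈ U) : tauC f X q 1 ≠ 0 := by
  intro h0
  have hs := hX.isSymplecticBasis hU
  have ht : tauR f X q 1 = ![-Om (X 2 q) (dR4 f q 1), -Om (X 3 q) (dR4 f q 1),
      Om (X 0 q) (dR4 f q 1), Om (X 1 q) (dR4 f q 1)] := hs.inv_mulVec _
  rw [tauC, ht, Complex.ext_iff] at h0
  simp only [Complex.zero_re, Complex.zero_im] at h0
  obtain ⟨u₁, u₂, -, h1, h2⟩ := hX.gauss q hU
  have e0 : Om (dR4 f q 1) (X 0 q) = 0 := by rw [← h1, hf.lagrangian]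
  have e1 : Om (dR4 f q 1) (X 1 q) = 0 := by rw [← h2, hf.lagrangian]
  have e2 : Om (dR4 f q 1) (X 2 q) = 0 := by rw [Om_swap]; simpa using h0.1
  have e3 : Om (dR4 f q 1) (X 3 q) = 0 := by rw [Om_swap]; simpa using h0.2
  have h := hs.expand (dR4 f q 1)
  simp only [e0, e1, e2, e3, zero_smul, add_zero, sub_zero] at h
  have hz : dR4 f q 0 = 0 := map_zero (mfderiv 𝓘(ℝ, ℂ) 𝓘(ℝ, R4) f q)
  exact one_ne_zero (hf.immersion q (h.trans hz.symm))

lemma omegaC_ne_zero [IsManifold 𝓘(ℝ, ℂ) ∞ M] (hf : IsElliptic f)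
    (hX : IsSecondOrderFrame f U X) {q : M} (hU : q ∈ U)
    {v : ℂ} (hv : v ≠ 0) : omegaC X q v ≠ 0 := by
  intro h0
  have hq := mem_chart_source ℂ q
  obtain ⟨r, hr, h⟩ := exists_gaussForm_eq (chart_mem_maximalAtlas_real q)
    hf.toIsLagrangianImmersion hX.toIsFirstOrderFrame hq hU
  have hg := h v
  have hp := hf.hess_pos (chart_mem_maximalAtlas_real q) hq
    (v := coordDeriv (chartAt ℂ q) q v) fun h0 => hv
      ((coordDeriv_bijective (chart_mem_maximalAtlas_real q) hq).1 (h0.trans (map_zero _).symm))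
  have ht := hX.trace_gamma q hU v
  rw [omegaC, Complex.ext_iff] at h0
  simp only [Complex.zero_re, Complex.zero_im] at h0
  have a : theta X q v 2 0 = 0 := by linarith [h0.1]
  have b : theta X q v 3 1 = 0 := by linarith [h0.1]
  rw [gaussForm, a, b, h0.2] at hg
  have := mul_pos hr hp
  rw [← hg] at this
  norm_num at this

lemma IsTotallyUmbilic.etaC_eq_zero [IsManifold 𝓘(ℝ, ℂ) ∞ M]
    (hf : IsTotallyUmbilic f) (hX : IsThirdOrderFrame f U X)
    {q : M} (hU : q ∈ U) (v : ℂ) : etaC X q v = 0 := by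
  by_cases hv : v = 0
  · obtain ⟨h, hh⟩ := hX.eta_type
    rw [hh q hU, hv, omegaC_eq_conn (chart_mem_maximalAtlas_real q) hX.toIsFirstOrderFrame
      (mem_chart_source ℂ q) hU]
    simp only [map_zero, conn, Om_eq, Pi.zero_apply]
    simp [Complex.ext_iff]
  · have h := hf.hopf_eq_zero U X hX q hU v
    have hω := omegaC_ne_zero hf.toIsElliptic hX.toIsSecondOrderFrame hU hv
    have hω1 := omegaC_ne_zero hf.toIsElliptic hX.toIsSecondOrderFrame hU one_ne_zero
    have hτ := tauC_ne_zero hf.toIsLagrangianImmersion hX.toIsFirstOrderFrame hU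
    rw [hopf, mul_eq_zero] at h
    rcases h with h | h
    · exfalso
      have h1 : 0 < ‖tCoeff f X q‖ := norm_pos_iff.2 (div_ne_zero hτ hω1)
      exact (Real.rpow_pos_of_pos h1 _).ne' (Complex.ofReal_eq_zero.1 h)
    · exact (mul_eq_zero.1 h).resolve_right hω

/-- Along a totally umbilic immersion the complex structure of `ℝ⁴` attached to a third order frame
is locally constant. -/
lemma IsTotallyUmbilic.eventually_cplx_eq [IsManifold 𝓘(ℝ, ℂ) ∞ M]
    (hf : IsTotallyUmbilic f) (hX : IsThirdOrderFrame f U X)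
    {q : M} (hU : q ∈ U) :
    ∀ᶠ q' in 𝓝 q, q' ∈ U ∧ cplx (fun i => X i q') = cplx fun i => X i q := by
  set z := chartAt ℂ q with hz0
  have hz : z ∈ IsManifold.maximalAtlas 𝓘(ℝ, ℂ) ∞ M := chart_mem_maximalAtlas_real q
  have hq : q ∈ z.source := mem_chart_source ℂ q
  have hP := hX.isPlaneFrame hz hf.toIsLagrangianImmersion
  set V := z.target ∩ z.symm ⁻¹' U with hV
  have hη : ∀ p ∈ V, ∀ v, conn (fun j => X j ∘ z.symm) p v 2 0
      - conn (fun j => X j ∘ z.symm) p v 3 1 = 0 ∧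
      conn (fun j => X j ∘ z.symm) p v 3 0 + conn (fun j => X j ∘ z.symm) p v 2 1 = 0 := by
    intro p hp v
    have hq' := z.map_target hp.1
    obtain ⟨v, rfl⟩ := (coordDeriv_bijective hz hq').2 v
    have h := hf.etaC_eq_zero hX hp.2 v
    rw [etaC_eq_conn hz hX.toIsFirstOrderFrame hq' hp.2, z.right_inv hp.1, Complex.ext_iff] at h
    simp only [Complex.zero_re, Complex.zero_im] at h
    exact ⟨by linarith [h.1], by linarith [h.2]⟩
  have hpos : ∀ p ∈ V, ∀ v, v ≠ 0 → 0 < hess (f ∘ z.symm) p v := by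
    intro p hp v hv
    have := hf.hess_pos hz (z.map_target hp.1) hv
    rwa [z.right_inv hp.1] at this
  have hD : ∀ p ∈ V, ∀ x, HasFDerivAt (fun p => cplx (fun i => (X i ∘ z.symm) p) x)
      (0 : ℂ →L[ℝ] R4) p := by
    intro p hp x
    refine fderiv_cplx_eq_zero (hP.eventually_symplectic hp) (hP.differentiableAt hp)
      (hX.conn_trace hz hp) (fun v => (hη p hp v).1) (fun v => (hη p hp v).2) ?_ x
    refine trace_beta_eq_zero (hP.eventually_symplectic hp) (hP.contDiffAt hp)
      (hX.conn_trace hz hp) ?_ ?_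
      (hP.omega_det_ne_zero hp (hX.conn_trace hz hp) (hpos p hp))
    · filter_upwards [hP.isOpen.mem_nhds hp] with p' hp' v using (hη p' hp' v).1
    · filter_upwards [hP.isOpen.mem_nhds hp] with p' hp' v using (hη p' hp' v).2
  obtain ⟨r, hr, hball⟩ := Metric.isOpen_iff.1 hP.isOpen _ (coord_mem hq hU)
  have hconst : ∀ p ∈ Metric.ball (z q) r, cplx (fun i => (X i ∘ z.symm) p)
      = cplx fun i => X i q := by
    intro p hp
    refine LinearMap.ext fun x => ?_
    have h := Metric.isOpen_ball.is_const_of_fderiv_eq_zero (𝕜 := ℝ)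
      (convex_ball (z q) r).isPreconnected
      (f := fun p => cplx (fun i => (X i ∘ z.symm) p) x)
      (fun p hp => (hD p (hball hp) x).differentiableAt.differentiableWithinAt)
      (fun p hp => (hD p (hball hp) x).fderiv) hp (Metric.mem_ball_self hr)
    simpa [z.left_inv hq] using h
  filter_upwards [hX.isOpen.mem_nhds hU, z.open_source.mem_nhds hq,
    (z.continuousAt hq).preimage_mem_nhds (Metric.ball_mem_nhds _ hr)] with q' h1 h2 h3
  refine ⟨h1, ?_⟩
  have := hconst _ h3
  simpa [z.left_inv h2] using this

/-- Along a totally umbilic immersion the complex structure of `ℝ⁴` attached to a third order frame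
does not depend on the frame. -/
lemma IsTotallyUmbilic.cplx_eq [IsManifold 𝓘(ℝ, ℂ) ∞ M]
    (ho : IsOrientedAtlas M) (hf : IsTotallyUmbilic f)
    (hX : IsThirdOrderFrame f U X)
    {U' : Set M} {X' : Fin 4 → M → R4} (hX' : IsThirdOrderFrame f U' X') {q : M} (hU : q ∈ U)
    (hU' : q ∈ U') : cplx (fun i => X i q) = cplx fun i => X' i q := by
  obtain ⟨z, hz0⟩ : ∃ z, z = chartAt ℂ q := ⟨_, rfl⟩
  have hza : z ∈ atlas ℂ M := hz0 ▸ chart_mem_atlas ℂ q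
  have hz : z ∈ IsManifold.maximalAtlas 𝓘(ℝ, ℂ) ∞ M := hz0 ▸ chart_mem_maximalAtlas_real q
  have hq : q ∈ z.source := hz0 ▸ mem_chart_source ℂ q
  have hL := hf.toIsLagrangianImmersion
  have hP := hX.isPlaneFrame hz hL
  have hP' := hX'.isPlaneFrame hz hL
  have hpos : ∀ p ∈ z.target, ∀ v, v ≠ 0 → 0 < hess (f ∘ z.symm) p v := by
    intro p hp v hv
    have := hf.hess_pos hz (z.map_target hp) hv
    rwa [z.right_inv hp] at this
  have hev : ∀ᶠ p in 𝓝 (z q), cplx (fun i => X i (z.symm p)) = cplx fun i => X i q := by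
    have h := (hf.eventually_cplx_eq hX hU).mono fun _ h => h.2
    have hc : Tendsto z.symm (𝓝 (z q)) (𝓝 q) := by
      have := z.continuousAt_symm (z.map_source hq)
      rw [ContinuousAt, z.left_inv hq] at this
      exact this
    exact hc.eventually h
  refine (hX'.unitary_of_adapted hz hL hq hU' (hpos _ (z.map_source hq))
    (hX.isSymplecticBasis hU).isOmComplex_cplx ?_).1
  filter_upwards [hev, hP.isOpen.mem_nhds (coord_mem hq hU),
    hP'.isOpen.mem_nhds (coord_mem hq hU')] with p hp hpU hpU'
  obtain ⟨y₀, y₁, hy, g0, g1⟩ := hX.exists_area_neg ho hza hL hpU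
  obtain ⟨w₀, w₁, hw, h0, h1⟩ := hX'.exists_area_neg ho hza hL hpU'
  rw [← h0, ← h1, ← hp]
  have hs := hX.isSymplecticBasis hpU.2
  refine adapted_of_adapted (y₀ := y₀) (y₁ := y₁) (hP.contDiffAt_map hpU)
    (hP.eventually_lagrangian hpU) (hpos p hpU.1) hy hw (fun v => ?_) (fun v => ?_) ?_ ?_
  · obtain ⟨e1, -, e3⟩ := hP.gamma_eq_cubic hpU g0 g1 v
    rw [← e1, ← e3]
    exact hX.conn_trace hz hpU v
  · obtain ⟨e1, -, e3⟩ := hP'.gamma_eq_cubic hpU' h0 h1 v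
    rw [← e1, ← e3]
    exact hX'.conn_trace hz hpU' v
  · rw [g0, g1]
    exact hs.cplx_zero
  · rw [g0, g1]
    exact hs.cplx_one

/-- On a connected surface, a totally umbilic immersion determines a constant complex structure
`N` of `ℝ⁴` for which the tangent planes are complex lines. -/
theorem IsTotallyUmbilic.exists_constant_cplx [IsManifold 𝓘(ℝ, ℂ) ∞ M]
    [ConnectedSpace M] (ho : IsOrientedAtlas M)
    (hf : IsTotallyUmbilic f) : ∃ e : Fin 4 → R4, IsSymplecticBasis e ∧
      ∀ q, ∃ u₀ u₁, area u₀ u₁ < 0 ∧ dR4 f q u₀ ≠ 0 ∧ cplx e (dR4 f q u₀) = -dR4 f q u₁ := by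
  have hex : ∀ q : M, ∃ X, IsThirdOrderFrame f (chartAt ℂ q).source X := fun q =>
    exists_isThirdOrderFrame ho hf.toIsLagrangianImmersion (chart_mem_atlas ℂ q)
      fun p hp v hv => by
        have := hf.hess_pos (chart_mem_maximalAtlas_real q) ((chartAt ℂ q).map_target hp) hv
        rwa [(chartAt ℂ q).right_inv hp] at this
  choose X hX using hex
  have hloc : IsLocallyConstant fun q => cplx fun i => X q i q := by
    rw [IsLocallyConstant.iff_eventually_eq]
    intro q
    filter_upwards [hf.eventually_cplx_eq (hX q) (mem_chart_source ℂ q)] with q' hq'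
    rw [← hq'.2]
    exact hf.cplx_eq ho (hX q') (hX q) (mem_chart_source ℂ q') hq'.1
  obtain ⟨q₀⟩ : Nonempty M := inferInstance
  refine ⟨fun i => X q₀ i q₀, (hX q₀).isSymplecticBasis (mem_chart_source ℂ q₀), fun q => ?_⟩
  have hs := (hX q).isSymplecticBasis (mem_chart_source ℂ q)
  obtain ⟨u₀, u₁, hu, h0, h1⟩ := (hX q).gauss q (mem_chart_source ℂ q)
  refine ⟨u₀, u₁, hu, fun hz => ?_, ?_⟩
  · have := hs.om02
    rw [← h0, hz, Om_zero_left] at this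
    exact zero_ne_one this
  · rw [hloc.apply_eq_of_preconnectedSpace q₀ q, h0, h1]
    exact hs.cplx_zero

end Umbilic

/-! ### Complex coordinates -/

lemma hasDerivAt_of_real {F : Type*} [NormedAddCommGroup F] [NormedSpace ℂ F] {h : ℂ → F}
    {L : ℂ →L[ℝ] F} {p : ℂ} {d : F} (hh : HasFDerivAt h L p) (hL : ∀ v, L v = v • d) :
    HasDerivAt h d p := by
  have : HasFDerivAt h (ContinuousLinearMap.toSpanSingleton ℂ d) p :=
    hasFDerivAt_of_restrictScalars ℝ hh (ContinuousLinearMap.ext fun v => by simp [hL])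
  simpa using this.hasDerivAt

lemma exists_combination {w₀ w₁ : ℂ} (hw : area w₀ w₁ ≠ 0) (v : ℂ) :
    ∃ x y : ℝ, v = x • w₀ + y • w₁ := by
  refine ⟨(area w₀ w₁)⁻¹ * area v w₁, (area w₀ w₁)⁻¹ * area w₀ v, ?_⟩
  have hk := inv_mul_cancel₀ hw
  set k := (area w₀ w₁)⁻¹
  unfold area at hk ⊢
  apply Complex.ext
  · simp only [Complex.add_re, Complex.smul_re, smul_eq_mul]
    linear_combination -v.re * hk
  · simp only [Complex.add_im, Complex.smul_im, smul_eq_mul]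
    linear_combination -v.im * hk

/-- The image of a real linear map `L` of the plane with `L w₁ = -i L w₀` lies in the complex line
spanned by `L w₀`. -/
lemma map_eq_smul {L : ℂ →L[ℝ] ℂ × ℂ} {w₀ w₁ : ℂ} (hw : area w₀ w₁ ≠ 0)
    (hL : L w₁ = -(Complex.I • L w₀)) (v : ℂ) :
    ∃ c : ℂ, L v = c • L w₀ ∧ (c = 0 → v = 0) := by
  obtain ⟨x, y, rfl⟩ := exists_combination hw v
  refine ⟨x - y * Complex.I, ?_, fun h0 => ?_⟩
  · rw [map_add, map_smul, map_smul, hL, ← Complex.coe_smul, ← Complex.coe_smul y]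
    module
  · rw [Complex.ext_iff] at h0
    simp at h0
    simp [h0.1, h0.2]

/-- If the tangent planes of a surface in `ℂ²` are complex lines then one of the coordinates of `ℂ²`
restricts to a complex coordinate. -/
lemma exists_holomorphic_coordinate {ψ : ℂ → ℂ × ℂ} {V : Set ℂ} (hV : IsOpen V)
    (hψ : ContDiffOn ℝ ∞ ψ V)
    (hline : ∀ p ∈ V, ∃ w₀ w₁, area w₀ w₁ ≠ 0 ∧ fderiv ℝ ψ p w₀ ≠ 0 ∧
      fderiv ℝ ψ p w₁ = -(Complex.I • fderiv ℝ ψ p w₀)) {p₀ : ℂ} (hp₀ : p₀ ∈ V) :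
    ∃ e : OpenPartialHomeomorph ℂ ℂ, p₀ ∈ e.source ∧ e.source ⊆ V ∧ ContDiffOn ℝ ∞ e e.source ∧
      ContDiffOn ℝ ∞ e.symm e.target ∧ DifferentiableOn ℂ (ψ ∘ e.symm) e.target := by
  obtain ⟨π, hπ⟩ : ∃ π : ℂ × ℂ →L[ℂ] ℂ, ∀ v, π (fderiv ℝ ψ p₀ v) = 0 → v = 0 := by
    obtain ⟨w₀, w₁, hw, hne, hL⟩ := hline p₀ hp₀
    obtain ⟨π, hπ⟩ : ∃ π : ℂ × ℂ →L[ℂ] ℂ, π (fderiv ℝ ψ p₀ w₀) ≠ 0 := by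
      by_contra! hall
      exact hne (Prod.ext (hall (ContinuousLinearMap.fst ℂ ℂ ℂ))
        (hall (ContinuousLinearMap.snd ℂ ℂ ℂ)))
    refine ⟨π, fun v hv => ?_⟩
    obtain ⟨c, hc, hc0⟩ := map_eq_smul hw hL v
    rw [hc, map_smul, smul_eq_mul] at hv
    exact hc0 ((mul_eq_zero.1 hv).resolve_right hπ)
  set g : ℂ → ℂ := fun p => π (ψ p) with hg
  have hgs : ContDiffOn ℝ ∞ g V := (π.restrictScalars ℝ).contDiff.comp_contDiffOn hψ
  have hgd : ∀ p ∈ V, HasFDerivAt g ((π.restrictScalars ℝ).comp (fderiv ℝ ψ p)) p := fun p hp =>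
    (π.restrictScalars ℝ).hasFDerivAt.comp p
      ((hψ.contDiffAt (hV.mem_nhds hp)).differentiableAt (by simp)).hasFDerivAt
  have hinj : Function.Injective ((π.restrictScalars ℝ).comp (fderiv ℝ ψ p₀) : ℂ →ₗ[ℝ] ℂ) := by
    rw [injective_iff_map_eq_zero]
    intro v hv
    exact hπ v hv
  set E₀ : ℂ ≃L[ℝ] ℂ := (LinearEquiv.ofInjectiveEndo _ hinj).toContinuousLinearEquiv with hE₀
  have hE₀c : (E₀ : ℂ →L[ℝ] ℂ) = (π.restrictScalars ℝ).comp (fderiv ℝ ψ p₀) :=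
    ContinuousLinearMap.ext fun v => rfl
  have hg₀ : HasFDerivAt g (E₀ : ℂ →L[ℝ] ℂ) p₀ := hE₀c ▸ hgd p₀ hp₀
  have hc₀ : ContDiffAt ℝ ∞ g p₀ := hgs.contDiffAt (hV.mem_nhds hp₀)
  set S : Set ℂ := V ∩ fderiv ℝ g ⁻¹' Set.range ((↑) : (ℂ ≃L[ℝ] ℂ) → ℂ →L[ℝ] ℂ) with hS
  have hSo : IsOpen S := (hgs.continuousOn_fderiv_of_isOpen hV (by simp)).isOpen_inter_preimage hV
    ContinuousLinearEquiv.isOpen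
  set e := (hc₀.toOpenPartialHomeomorph g hg₀ (by simp)).restrOpen S hSo with he
  have heg : ∀ p, e p = g p := fun p => rfl
  have hsrc : ∀ p ∈ e.source, p ∈ S := fun p hp => by
    rw [he, OpenPartialHomeomorph.restrOpen_source] at hp
    exact hp.2
  have hsymm : ∀ y ∈ e.target, ∃ E : ℂ ≃L[ℝ] ℂ, HasFDerivAt e (E : ℂ →L[ℝ] ℂ) (e.symm y) ∧
      (E : ℂ →L[ℝ] ℂ) = (π.restrictScalars ℝ).comp (fderiv ℝ ψ (e.symm y)) := by
    intro y hy
    obtain ⟨hpV, E, hE⟩ := hsrc _ (e.map_target hy)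
    have hd := hgd _ hpV
    rw [hd.fderiv] at hE
    exact ⟨E, hE ▸ hd, hE⟩
  refine ⟨e, ?_, fun p hp => (hsrc p hp).1, hgs.mono fun p hp => (hsrc p hp).1, ?_, ?_⟩
  · rw [he, OpenPartialHomeomorph.restrOpen_source]
    exact ⟨hc₀.mem_toOpenPartialHomeomorph_source hg₀ (by simp), hp₀, E₀, hg₀.fderiv.symm⟩
  · intro y hy
    obtain ⟨E, hE, -⟩ := hsymm y hy
    exact (e.contDiffAt_symm hy hE
      (hgs.contDiffAt (hV.mem_nhds (hsrc _ (e.map_target hy)).1))).contDiffWithinAt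
  · intro y hy
    obtain ⟨E, hE, hEc⟩ := hsymm y hy
    have hpV := (hsrc _ (e.map_target hy)).1
    have hd : HasFDerivAt (ψ ∘ e.symm) ((fderiv ℝ ψ (e.symm y)).comp (E.symm : ℂ →L[ℝ] ℂ)) y :=
      HasFDerivAt.comp y
        ((hψ.contDiffAt (hV.mem_nhds hpV)).differentiableAt (by simp)).hasFDerivAt
        (e.hasFDerivAt_symm hy hE)
    obtain ⟨w₀, w₁, hw, hne, hL⟩ := hline _ hpV
    have hEv : ∀ v, E v = π (fderiv ℝ ψ (e.symm y) v) := fun v =>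
      congrArg (fun L : ℂ →L[ℝ] ℂ => L v) hEc
    have hπ0 : π (fderiv ℝ ψ (e.symm y) w₀) ≠ 0 := by
      rw [← hEv]
      intro h0
      apply hne
      rw [E.map_eq_zero_iff.1 h0, map_zero]
    refine (hasDerivAt_of_real (d := (π (fderiv ℝ ψ (e.symm y) w₀))⁻¹ • fderiv ℝ ψ (e.symm y) w₀)
      hd fun v => ?_).differentiableAt.differentiableWithinAt
    obtain ⟨c, hc, -⟩ := map_eq_smul hw hL (E.symm v)
    have hv : v = c * π (fderiv ℝ ψ (e.symm y) w₀) := by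
      rw [← smul_eq_mul, ← map_smul, ← hc, ← hEv, E.apply_symm_apply]
    change fderiv ℝ ψ (e.symm y) (E.symm v) = _
    rw [hc, smul_smul]
    congr 1
    conv_rhs => rw [hv]
    rw [mul_assoc, mul_inv_cancel₀ hπ0, mul_one]

section Criteria

variable {M : Type*} [TopologicalSpace M] [c₀ : ChartedSpace ℂ M]

lemma isRiemannSurface_of_differentiableOn (h : ∀ e ∈ atlas ℂ M, ∀ e' ∈ atlas ℂ M,
    DifferentiableOn ℂ (e.symm ≫ₕ e') (e.symm ≫ₕ e').source) :
    IsRiemannSurface c₀ := by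
  change IsManifold 𝓘(ℂ) ω M
  apply isManifold_of_contDiffOn
  intro e e' he he'
  have := (h e he e' he').contDiffOn (n := ω) (e.symm ≫ₕ e').open_source
  simpa using this

lemma isFlexFreeComplexCurve_of_coordinates {F : M → ℂ × ℂ} (hc : Continuous F)
    (h : ∀ z ∈ atlas ℂ M, DifferentiableOn ℂ (F ∘ z.symm) z.target)
    (hW : ∀ z ∈ atlas ℂ M, ∀ p ∈ z.target,
      det2 (deriv (F ∘ z.symm) p) (deriv (deriv (F ∘ z.symm)) p) ≠ 0) :
    IsFlexFreeComplexCurve c₀ F := by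
  have hd : ∀ q, DifferentiableAt ℂ (F ∘ (chartAt ℂ q).symm) (chartAt ℂ q q) := fun q =>
    (h _ (chart_mem_atlas ℂ q)).differentiableAt
      ((chartAt ℂ q).open_target.mem_nhds (mem_chart_target ℂ q))
  have hF : MDifferentiable 𝓘(ℂ) 𝓘(ℂ, ℂ × ℂ) F := by
    intro q
    rw [mdifferentiableAt_iff]
    refine ⟨hc.continuousAt, ?_⟩
    change DifferentiableWithinAt ℂ (F ∘ (chartAt ℂ q).symm) (Set.range id) (chartAt ℂ q q)
    exact (hd q).differentiableWithinAt
  refine ⟨hF, fun q => ?_, fun z hz q hq => hW z hz _ (z.map_source hq)⟩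
  have hm : mfderiv 𝓘(ℂ) 𝓘(ℂ, ℂ × ℂ) F q
      = fderiv ℂ (F ∘ (chartAt ℂ q).symm) (chartAt ℂ q q) := by
    rw [(hF q).mfderiv, ← fderivWithin_univ]
    change fderivWithin ℂ (F ∘ (chartAt ℂ q).symm) (Set.range id) (chartAt ℂ q q) = _
    rw [Set.range_id]
  intro (a : ℂ) (b : ℂ) hab
  have hab' : fderiv ℂ (F ∘ (chartAt ℂ q).symm) (chartAt ℂ q q) a
      = fderiv ℂ (F ∘ (chartAt ℂ q).symm) (chartAt ℂ q q) b := hm ▸ hab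
  rw [fderiv_eq_smul_deriv, fderiv_eq_smul_deriv] at hab'
  refine smul_left_injective ℂ (fun h0 => ?_) hab'
  apply hW _ (chart_mem_atlas ℂ q) _ (mem_chart_target ℂ q)
  rw [h0]
  simp [det2]

end Criteria

/-! ### Totally umbilic immersions are complex curves -/

section HolomorphicAtlas

variable {M : Type*} [TopologicalSpace M] [c₀ : ChartedSpace ℂ M]

/-- The smooth coordinates of `M` in which the map `A ∘ f` into `ℂ²` is holomorphic. -/
def holomorphicAtlas (A : R4 →L[ℝ] ℂ × ℂ) (f : M → R4) : Set (OpenPartialHomeomorph M ℂ) :=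
  {z | z ∈ IsManifold.maximalAtlas 𝓘(ℝ, ℂ) ∞ M ∧
    DifferentiableOn ℂ (fun p => A ((f ∘ z.symm) p)) z.target}

variable {A : R4 →L[ℝ] ℂ × ℂ} {f : M → R4}

lemma contDiffOn_coord {z : OpenPartialHomeomorph M ℂ}
    (hz : z ∈ IsManifold.maximalAtlas 𝓘(ℝ, ℂ) ∞ M) (hf : IsLagrangianImmersion f) :
    ContDiffOn ℝ ∞ (f ∘ z.symm) z.target := by
  have := contDiffOn_comp_symm hz hf.smooth.contMDiffOn (U := Set.univ)
  simpa using this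

lemma dR4_eq_fderiv {z : OpenPartialHomeomorph M ℂ}
    (hz : z ∈ IsManifold.maximalAtlas 𝓘(ℝ, ℂ) ∞ M) (hf : IsLagrangianImmersion f) {q : M}
    (hq : q ∈ z.source) (v : ℂ) :
    dR4 f q v = fderiv ℝ (f ∘ z.symm) (z q) (coordDeriv z q v) :=
  dR4_eq hz hq (((contDiffOn_coord hz hf).contDiffAt
    (z.open_target.mem_nhds (z.map_source hq))).differentiableAt (by simp)) v

lemma map_dR4_of_mem_holomorphicAtlas (hf : IsLagrangianImmersion f)
    {z : OpenPartialHomeomorph M ℂ} (hz : z ∈ holomorphicAtlas A f) {q : M} (hq : q ∈ z.source)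
    (v : ℂ) : A (dR4 f q v) = coordDeriv z q v • deriv (fun p => A ((f ∘ z.symm) p)) (z q) := by
  rw [dR4_eq_fderiv hz.1 hf hq, map_fderiv_of_holomorphic z.open_target
    (contDiffOn_coord hz.1 hf) hz.2 (z.map_source hq)]

variable (hline : ∀ q, ∃ u₀ u₁, area u₀ u₁ < 0 ∧ A (dR4 f q u₀) ≠ 0 ∧
  A (dR4 f q u₁) = -(Complex.I • A (dR4 f q u₀)))

include hline in
lemma deriv_ne_zero_of_mem_holomorphicAtlas (hf : IsLagrangianImmersion f)
    {z : OpenPartialHomeomorph M ℂ} (hz : z ∈ holomorphicAtlas A f) {q : M} (hq : q ∈ z.source) :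
    deriv (fun p => A ((f ∘ z.symm) p)) (z q) ≠ 0 := by
  intro h0
  obtain ⟨u₀, -, -, hne, -⟩ := hline q
  rw [map_dR4_of_mem_holomorphicAtlas hf hz hq, h0, smul_zero] at hne
  exact hne rfl

include hline in
lemma exists_mem_holomorphicAtlas [IsManifold 𝓘(ℝ, ℂ) ∞ M] (hf : IsLagrangianImmersion f) (q : M) :
    ∃ z ∈ holomorphicAtlas A f, q ∈ z.source := by
  set z := chartAt ℂ q with hz0
  have hz : z ∈ IsManifold.maximalAtlas 𝓘(ℝ, ℂ) ∞ M := chart_mem_maximalAtlas_real q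
  have hφ := contDiffOn_coord hz hf
  obtain ⟨e, h1, h2, h3, h4, h5⟩ := exists_holomorphic_coordinate
    (ψ := fun p => A ((f ∘ z.symm) p)) z.open_target (A.contDiff.comp_contDiffOn hφ) (by
      intro p hp
      obtain ⟨u₀, u₁, hu, hne, hL⟩ := hline (z.symm p)
      have hq' := z.map_target hp
      have hd : fderiv ℝ (fun p => A ((f ∘ z.symm) p)) p = A.comp (fderiv ℝ (f ∘ z.symm) p) :=
        (A.hasFDerivAt.comp p ((hφ.contDiffAt (z.open_target.mem_nhds hp)).differentiableAt
          (by simp)).hasFDerivAt).fderiv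
      refine ⟨coordDeriv z (z.symm p) u₀, coordDeriv z (z.symm p) u₁, ?_, ?_, ?_⟩
      · rw [area_map]
        exact mul_ne_zero (area_coordDeriv_ne_zero hz hq') hu.ne
      · rw [dR4_eq_fderiv hz hf hq', z.right_inv hp] at hne
        rw [hd]
        exact hne
      · rw [dR4_eq_fderiv hz hf hq', dR4_eq_fderiv hz hf hq', z.right_inv hp] at hL
        rw [hd]
        exact hL) (mem_chart_target ℂ q)
  refine ⟨z ≫ₕ e, ⟨?_, ?_⟩, ?_⟩
  · apply OpenPartialHomeomorph.mem_maximalAtlas_of_contMDiffOn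
    · rw [OpenPartialHomeomorph.trans_source]
      exact h3.contMDiffOn.comp ((contMDiffOn_of_mem_maximalAtlas hz).mono Set.inter_subset_left)
        fun _ hx => hx.2
    · rw [OpenPartialHomeomorph.trans_target]
      exact (contMDiffOn_symm_of_mem_maximalAtlas hz).comp
        (h4.contMDiffOn.mono Set.inter_subset_left) fun _ hx => hx.2
  · rw [OpenPartialHomeomorph.trans_target]
    exact h5.mono Set.inter_subset_left
  · rw [OpenPartialHomeomorph.trans_source]
    exact ⟨mem_chart_source ℂ q, h1⟩

include hline in
lemma differentiableOn_transition (hf : IsLagrangianImmersion f)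
    {z z' : OpenPartialHomeomorph M ℂ} (hz : z ∈ holomorphicAtlas A f)
    (hz' : z' ∈ holomorphicAtlas A f) :
    DifferentiableOn ℂ (z.symm ≫ₕ z') (z.symm ≫ₕ z').source := by
  intro p hp
  have hp' := hp
  rw [OpenPartialHomeomorph.trans_source] at hp'
  have hpt : p ∈ z.target := hp'.1
  have hq : z.symm p ∈ z'.source := hp'.2
  have hT : DifferentiableAt ℝ (z.symm ≫ₕ z') p := by
    have h := (contMDiffOn_of_mem_contDiffGroupoid
      ((contDiffGroupoid ∞ 𝓘(ℝ, ℂ)).compatible_of_mem_maximalAtlas hz.1 hz'.1)).contDiffOn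
    exact (h.contDiffAt ((z.symm ≫ₕ z').open_source.mem_nhds hp)).differentiableAt (by simp)
  set ψ := fun p => A ((f ∘ z.symm) p) with hψ
  set ψ' := fun p => A ((f ∘ z'.symm) p) with hψ'
  have hd := (hz.2.differentiableAt (z.open_target.mem_nhds hpt)).hasDerivAt
  have hd' := (hz'.2.differentiableAt (z'.open_target.mem_nhds (z'.map_source hq))).hasDerivAt
  have hne := deriv_ne_zero_of_mem_holomorphicAtlas hline hf hz' hq
  have e : ψ' ∘ (z.symm ≫ₕ z') =ᶠ[𝓝 p] ψ := by
    filter_upwards [(z.symm ≫ₕ z').open_source.mem_nhds hp] with p' hp'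
    rw [OpenPartialHomeomorph.trans_source] at hp'
    have : z'.symm (z' (z.symm p')) = z.symm p' := z'.left_inv hp'.2
    simp [hψ, hψ', this]
  have hcomp : HasFDerivAt ψ (((ContinuousLinearMap.toSpanSingleton ℂ
      (deriv ψ' (z' (z.symm p)))).restrictScalars ℝ).comp (fderiv ℝ (z.symm ≫ₕ z') p)) p :=
    (HasFDerivAt.comp p (hd'.hasFDerivAt.restrictScalars ℝ) hT.hasFDerivAt).congr_of_eventuallyEq
      e.symm
  have hu := hcomp.unique (hd.hasFDerivAt.restrictScalars ℝ)
  have huv : ∀ v, fderiv ℝ (z.symm ≫ₕ z') p v • deriv ψ' (z' (z.symm p)) = v • deriv ψ p :=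
    fun v => congrArg (fun L : ℂ →L[ℝ] ℂ × ℂ => L v) hu
  obtain ⟨π, hπ⟩ : ∃ π : ℂ × ℂ →L[ℂ] ℂ, π (deriv ψ' (z' (z.symm p))) ≠ 0 := by
    by_contra! hall
    exact hne (Prod.ext (hall (ContinuousLinearMap.fst ℂ ℂ ℂ))
      (hall (ContinuousLinearMap.snd ℂ ℂ ℂ)))
  refine (hasDerivAt_of_real (d := π (deriv ψ p) / π (deriv ψ' (z' (z.symm p))))
    hT.hasFDerivAt fun v => ?_).differentiableAt.differentiableWithinAt
  have := congrArg π (huv v)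
  rw [map_smul, map_smul, smul_eq_mul, smul_eq_mul] at this
  rw [smul_eq_mul, mul_div_assoc', eq_div_iff hπ, this]

lemma no_flex_of_mem_holomorphicAtlas (hf : IsElliptic f)
    (hA : ∀ x y, Om x y = (det2 (A x) (A y)).re) {z : OpenPartialHomeomorph M ℂ}
    (hz : z ∈ holomorphicAtlas A f) {p : ℂ} (hp : p ∈ z.target) :
    det2 (deriv (fun p => A ((f ∘ z.symm) p)) p)
      (deriv (deriv (fun p => A ((f ∘ z.symm) p))) p) ≠ 0 := by
  intro h0
  have h := hf.hess_pos hz.1 (z.map_target hp) one_ne_zero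
  rw [z.right_inv hp, hess_of_holomorphic z.open_target
    (contDiffOn_coord hz.1 hf.toIsLagrangianImmersion) hA hz.2 hp, h0] at h
  simp at h

include hline in
lemma isInducedCoordinate_of_mem_holomorphicAtlas (hf : IsElliptic f)
    (hA : ∀ x y, Om x y = (det2 (A x) (A y)).re) {z : OpenPartialHomeomorph M ℂ}
    (hz : z ∈ holomorphicAtlas A f) : IsInducedCoordinate f z := by
  have hL := hf.toIsLagrangianImmersion
  refine ⟨hz.1, fun q hq => ?_, fun q hq U X hU hX => ?_⟩
  · obtain ⟨u₀, u₁, hu, hne, hI⟩ := hline q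
    rw [map_dR4_of_mem_holomorphicAtlas hL hz hq, map_dR4_of_mem_holomorphicAtlas hL hz hq,
      smul_smul, ← neg_smul] at hI
    have h1 := smul_left_injective ℂ (deriv_ne_zero_of_mem_holomorphicAtlas hline hL hz hq) hI
    have h2 := area_map (coordDeriv z q) u₀ u₁
    have h3 : area (coordDeriv z q u₀) (coordDeriv z q u₁) ≤ 0 := by
      rw [h1]
      simp [area]
      nlinarith [mul_self_nonneg (coordDeriv z q u₀).re, mul_self_nonneg (coordDeriv z q u₀).im]
    rw [h2] at h3
    exact lt_of_le_of_ne (nonneg_of_mul_nonpos_left h3 hu) (area_coordDeriv_ne_zero hz.1 hq).symm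
  · obtain ⟨r, hr, h⟩ := exists_gaussForm_eq hz.1 hL hX hq hU
    refine ⟨_, mul_pos hr (Complex.normSq_pos.2
      (no_flex_of_mem_holomorphicAtlas hf hA hz (z.map_source hq))), fun v => ?_⟩
    rw [h, hess_of_holomorphic z.open_target (contDiffOn_coord hz.1 hL) hA hz.2 (z.map_source hq),
      mul_assoc]
    rfl

include hline in
/-- If the tangent planes of `A ∘ f` are complex lines, then `A ∘ f` is a complex curve for the
complex structure induced by the Gauss map. -/
theorem exists_induced_complex_structure [IsManifold 𝓘(ℝ, ℂ) ∞ M] (hf : IsElliptic f)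
    (hA : ∀ x y, Om x y = (det2 (A x) (A y)).re) : ∃ c : ChartedSpace ℂ M,
      IsInducedComplexStructure c₀ f c ∧ IsFlexFreeComplexCurve c fun q => A (f q) := by
  have hL := hf.toIsLagrangianImmersion
  choose z hz hq using exists_mem_holomorphicAtlas hline hL
  have hind := fun z hz =>
    isInducedCoordinate_of_mem_holomorphicAtlas hline hf hA (z := z) hz
  have hflex := fun z (hz : z ∈ holomorphicAtlas A f) p (hp : p ∈ z.target) =>
    no_flex_of_mem_holomorphicAtlas hf hA hz hp
  have htrans := fun z (hz : z ∈ holomorphicAtlas A f) z' (hz' : z' ∈ holomorphicAtlas A f) =>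
    differentiableOn_transition hline hL hz hz'
  have hcont : Continuous fun q => A (f q) := A.continuous.comp hL.smooth.continuous
  have hhol : ∀ z ∈ holomorphicAtlas A f,
      DifferentiableOn ℂ (fun p => A ((f ∘ z.symm) p)) z.target := fun z hz => hz.2
  generalize holomorphicAtlas A f = 𝒜 at hz hind hflex htrans hhol
  obtain ⟨c, hc⟩ : ∃ c : ChartedSpace ℂ M, c.atlas = 𝒜 := by
    exact ⟨ChartedSpace.mk 𝒜 z hq hz, rfl⟩
  subst hc
  exact ⟨c, ⟨isRiemannSurface_of_differentiableOn htrans, hind⟩,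
    isFlexFreeComplexCurve_of_coordinates hcont hhol hflex⟩

/-- A totally umbilic immersion becomes a complex curve after a linear symplectic change of
coordinates that takes its constant complex structure to the standard one. -/
theorem IsTotallyUmbilic.exists_complexCurve [IsManifold 𝓘(ℝ, ℂ) ∞ M] [ConnectedSpace M]
    (ho : IsOrientedAtlas M) (hf : IsTotallyUmbilic f) :
    ∃ c : ChartedSpace ℂ M, IsInducedComplexStructure c₀ f c ∧ ∃ D : AffineSymplectic,
      IsFlexFreeComplexCurve c fun q => toC2 (D.act (f q)) := by
  obtain ⟨e, he, hline⟩ := hf.exists_constant_cplx ho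
  set E : Matrix (Fin 4) (Fin 4) ℝ := Matrix.of fun i j => e j i with hE
  have hEs : Eᵀ * J * E = J := he.matrix_symplectic
  have hEinv : E * E⁻¹ = 1 := by
    rw [he.inv_eq]
    exact mul_eq_one_comm.1 (symplectic_mul_eq _ hEs)
  have hEs' : E⁻¹ᵀ * J * E⁻¹ = J := by
    have hT : E⁻¹ᵀ * Eᵀ = 1 := by rw [← Matrix.transpose_mul, hEinv, Matrix.transpose_one]
    calc E⁻¹ᵀ * J * E⁻¹ = E⁻¹ᵀ * (Eᵀ * J * E) * E⁻¹ := by rw [hEs]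
      _ = (E⁻¹ᵀ * Eᵀ) * J * (E * E⁻¹) := by simp only [Matrix.mul_assoc]
      _ = J := by rw [hT, hEinv, one_mul, mul_one]
  set A : R4 →L[ℝ] ℂ × ℂ :=
    (toC2Equiv : R4 →L[ℝ] ℂ × ℂ).comp (Matrix.toLin' E⁻¹).toContinuousLinearMap with hAdef
  have hAapp : ∀ x, A x = toC2 (E⁻¹ *ᵥ x) := fun x => rfl
  have hA : ∀ x y, Om x y = (det2 (A x) (A y)).re := fun x y => by
    rw [← Om_mulVec _ hEs', Om_eq_det2]
    rfl
  have hAN : ∀ x, A (cplx e x) = Complex.I • A x := by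
    intro x
    have hN := he.isOmComplex_cplx
    rw [hAapp, hAapp, hE, he.inv_mulVec, he.inv_mulVec]
    simp only [← hN.adj, he.cplx_zero, he.cplx_one, he.cplx_two, he.cplx_three, Om_neg_left, toC2,
      Prod.smul_mk]
    congr 1 <;> (apply Complex.ext <;> simp)
  have hAinj : ∀ x, A x = 0 → x = 0 := by
    intro x hx
    have h1 : E⁻¹ *ᵥ x = 0 := toC2Equiv.map_eq_zero_iff.1 hx
    have h2 : E *ᵥ (E⁻¹ *ᵥ x) = x := by rw [Matrix.mulVec_mulVec, hEinv, Matrix.one_mulVec]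
    rw [← h2, h1, Matrix.mulVec_zero]
  obtain ⟨c, hc, hcurve⟩ := exists_induced_complex_structure (A := A) (f := f) (fun q => by
    obtain ⟨u₀, u₁, hu, hne, hI⟩ := hline q
    refine ⟨u₀, u₁, hu, fun h0 => hne (hAinj _ h0), ?_⟩
    rw [← hAN, hI, map_neg, neg_neg]) hf.toIsElliptic hA
  refine ⟨c, hc, ⟨0, E⁻¹, hEs'⟩, ?_⟩
  simp only [AffineSymplectic.act, zero_add]
  exact hcurve

end HolomorphicAtlas

end SymplecticSurface

end

theorem proposition4 {M : Type*} [TopologicalSpace M] [T2Space M] [ConnectedSpace M]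
    [c₀ : ChartedSpace ℂ M] (f : M → SymplecticSurface.R4) :
    -- `M` a Riemann surface, `f` a complex curve without flex points
    (SymplecticSurface.IsRiemannSurface c₀ →
      SymplecticSurface.IsFlexFreeComplexCurve c₀ (fun q => SymplecticSurface.toC2 (f q)) →
      SymplecticSurface.IsTotallyUmbilic f ∧ SymplecticSurface.HasThirdOrderFrames f) ∧
    -- `M` an oriented smooth surface, `f` a totally umbilic elliptic Lagrangian immersion
    (IsManifold 𝓘(ℝ, ℂ) ∞ M → SymplecticSurface.IsOrientedAtlas M →
      SymplecticSurface.IsTotallyUmbilic f →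
      ∃ c : ChartedSpace ℂ M, SymplecticSurface.IsInducedComplexStructure c₀ f c ∧
        ∃ D : SymplecticSurface.AffineSymplectic,
          SymplecticSurface.IsFlexFreeComplexCurve c
            (fun q => SymplecticSurface.toC2 (D.act (f q)))) :=
  ⟨fun hM hF => SymplecticSurface.isTotallyUmbilic_of_complexCurve hM hF,
    fun _ ho hf => hf.exists_complexCurve ho⟩
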